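/- Let $G=\mathrm{PSL}(2,61)$ and let $H\le G$ be any subgroup isomorphic to the alternating group $A_5$. Consider the action of $G$ by left multiplication on the set $G/H$ of left cosets. An orbital of this action is an orbit of $G$ acting componentwise on $G/H\times G/H$; the diagonal is one of the orbitals. An orbital graph of this action is a simple undirected graph with vertex set $G/H$ whose adjacency relation is the union of a nonempty family of orbitals, none of them the diagonal (the union being closed under $(x,y)\mapsto(y,x)$). Then $|G/H|=1891=31\cdot 61$, and every orbital graph of this action contains a Hamilton cycle, that is, a cycle passing through every vertex exactly once. -/

import Mathlib

/-- An orbital of an action of `G` on `V` is an orbit of the componentwise action of `G`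
on `V × V`. -/
def IsOrbital (G : Type*) {V : Type*} [Group G] [MulAction G V] (O : Set (V × V)) : Prop :=
  ∃ x y : V, O = MulAction.orbit G (x, y)

/-- `X` is a (generalized, undirected) orbital graph of the action of `G` on `V`: its adjacency
relation is the union of a nonempty family of orbitals, none of which is the diagonal.
The union is automatically closed under swapping coordinates, because adjacency in a
`SimpleGraph` is symmetric. -/
def IsOrbitalGraph (G : Type*) {V : Type*} [Group G] [MulAction G V] (X : SimpleGraph V) : Prop :=
  ∃ F : Set (Set (V × V)), F.Nonempty ∧
    (∀ O ∈ F, IsOrbital G O ∧ O ≠ Set.diagonal V) ∧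
    ∀ x y : V, X.Adj x y ↔ (x, y) ∈ ⋃₀ F

/-! Certificates for the action of `PSL(2, 61)` on the cosets of `A₅`.  A matrix `!![a, b; c, d]`
over `ZMod 61` is coded by the number `a + 64 * b + 64 ^ 2 * c + 64 ^ 3 * d`. -/

namespace PSL61

/-! Let `U` be the group of upper unipotent matrices, of order 61, and `binIco` the binary
icosahedral group in SL(2,61). Since 61 does not divide |H| = 60, `U` acts freely on the cosets of
H. A matrix modulo `U` on the left is its bottom row, so the `U`-orbits on G/H correspond to the
icosahedral orbits of nonzero row vectors. There are 31 of them, which gives 61 · 31 vertices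
(`card_quotient`).

An orbital graph contains, for some representative d of a nontrivial double coset of H, all arcs
from xH to xhdH with h icosahedral (`IsOrbitalGraph.exists_dcoset_adj`). Further edges do no harm,
so 40 digraphs remain. In each of them a closed walk in the quotient by `U`, visiting each of the 31
orbits once, lifts to a path from a vertex to its translate by some u in `U`. If u is nontrivial it
generates `U`, because 61 is prime, and the 61 translates of the path join up to a Hamilton cycle
(`exists_walk`, `exists_isHamiltonianCycle`). Such walks are tabulated and verified by arithmetic
modulo 61.

An arbitrary H is reduced to the standard one by traces. Generators of A₅ of orders 2 and 3 with
product of order 5 lift to matrices of traces 0 and 1 whose product has trace t with t² - t - 1 = 0.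
These traces fix the pair up to conjugacy in GL(2,61), and the two roots t yield conjugate subgroups
(`exists_conj_closure_eq`). Hence H is the image of `binIco` under some surjection from SL(2,61) to
PSL(2,61) with kernel ±1 (`exists_projection`); the argument above needs only this and |H| = 60. -/

/-- Packed list (32 bits per entry) of the matrices of the binary icosahedral group generated by
`stdA` and `stdB`; the top byte `2 * j + e` of a nonzero entry says that it is the `j`-th entry times
the generator number `e`. -/
def icoTable : ℕ :=
  8011287941494122768361634185107608655241971815175013918214053331314834905676927169099457245145123629567670975798463355470138028781155961389580434281097742197874104777563167152341113986938734818173216420960303373803027822825806182963977551230325628643793655102267306104706160823997156785572115243478330010928424389304490114717694810916881282337031270000321912723694285938729535636799266629412173794267490888353078371221405146413696977322229179763582802229013806659380091154314429174480181076633879300971426215323012231509470967868536404614643827729964597147262771968824928311985205381413443531518172576755570977253321038211222114842593797032277403097057234796994059110921032440223624583007016998080689021165902698272450813463474694546835482313386240196446203382763868644949431641337916108140927718473775899339907436519610036897001706439170414362279532448234765751572312676907760155072923962507388047274779276211722652025681334364179668392635517176208478488864717700226878861432318490486489865488253682682156997962965154246744086365771177521390321744951317546185678590274812388144187460433415832010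141953472185477347200456721110204430415437448490086698319873

/-- Packed list (24 bits per entry) of representatives of the double cosets of unipotent matrices
and the binary icosahedral group. -/
def repTable : ℕ :=
  75209292809018988381155049364992184508476631629051843214518378670369391295830347225393000903086030293312167673846479958514773381876737483261029433752416360493252793561198287127666663893861814166050148342038101626442288988161

/-- Packed list (24 bits per entry) of representatives of the double cosets of the binary
icosahedral group. -/
def dcosetTable : ℕ :=
  3155929998403931242817794236097208520709989847430433469616003394319530284936061625730085968100878513387320258610004042249479715842517690537409413089309464417582425818784917806718492267437025871289823746126008595907103499965975658585196103603215077087004876693309156909267107212893967867003011073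

/-- The entry `d` (12 bits) of the row `c` is `128 * j + i`, where the vector `(c, d)` times the
`i`-th icosahedral matrix is the bottom row of the `j`-th representative. -/
def rowTable : List ℕ := [
  16723445886422187329638506964531157466299718955798108224219354499702586796261936167514841652863697563191601055389683630959898229293378673095974611385714159944021842275884126707483025534340069175710770037686821873254400,
  10635508530471260899071595676645965214123899359466712420171819487711970407574713122460354238763215010519552280270336430052092774123636648570157768166587611213472045185535310285167085381761362413336873624362358269863325704,
  11343691028651690944533512337468305577551682986442905293423540585013972994815677743614786636860544111504147417781238681064621823982930246908920776220589460844927966181440922022413516974830914769266675306195849846334222472,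
  162008760013844560300283614781135934824583610101718859302421040706538385731051215441839538621576066315334349939947443345810759647882796012180912019053711979097608867907553876788243305577889781133957585341694020111216904,
  104552252231500168580596538300760197605694553731847517676575511362488720415591720322820489164225346949343240620989945361769523307178565859384714567222274195147346824410072020970759522802283421984383769953132764899418504,
  11484896426469925378996039313202607807852567150809882996560722056954258649204563165122614474895392975753009073459513727841556522710858781582078970207485542261710776399021724150540409878813593120008644610464072891421807112,
  5328332366983797691573358310049734441225931834597368107935215406318668250707535882570431727304765586663651848448360043385944732588907521201791256811160573308576881731393823015593011013942589832626465586503140061664698885,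
  9026433403290551029714784444318963325420640465320097859898861786897445315565290757484108058839296144326878236790150848416771307510078469888329702524438063514008615542162133099494406651906742056310111357096010716938859144,
  12046381671367619684532947130964192529719151175947438677513585130485874172808444185420415486199418909135455549923851853593534860138536757882050205703165850115274683828090499425150457223205055263124237424897839777226830600,
  7465308852190091381376556041103497841558627353486256520924804764583627365048513979034510282531320469089046664695113657149819500189557835626131981352311265592030898522412572966331455316625848356128937181213983399263662984,
  12757408081473117307404263581172783855773423764280278083426550155158103168207028700630726391277057189858048659496636165004350523302200030940218481367907715194979958182598863313418339041643880881086688675432424706721981448,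
  13462996505063032149556154991575547132305285237091067418900404756532364418426126149285562283869746612516647568192666438427477559145052340683254177758280006922719021537934040730685654707887232446486287030090499935962775566,
  5721701555128709265697924109195783567179235468748721420601654627360342653742406006780965230445520440427597022595171855640053441063219878244475963723553571818948953345797584923355431548529517808988712121650214759523132421,
  14168199798366303206087471031211396796471004546089171614800958675170207701573821323399518342850988345930428607729887492092014342818048999362019619373216966891778109474610546945357339880795330646081178659315188064351761544,
  7932857737412170258684269690178321850876345162029500527891316511037649785602743245233354625808940809214888421245186737808031758719178282640334386866866142018244338061835446936387391801668699766571133608063903040704881928,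
  7950408280278815624124677274955247775862161044873861396886680159440912479458886451581811275119499690245765474640167074393274043017213625290342396683750071655525601149045064645321282951695336171629680597484818583846397320,
  14875128228724045435881389657259769502964838605842648339712506434185172138366754380316014924541603367122005340050119950000812947154422701689801328057737301949606527654958739126823940410938772443925784559367471864006484622,
  15577728298664919872707671221318338720830461941397432063941803115924062057023603371743453976920512999750328537437215174392962363801742120117090413699878680564016223551254738053268512549006226356333144177540281622028579205,
  16282664947514503115967761810819585459493572868032570025065687611319063147949321506272169508527220516210750632428400477980829689862809592523982090088505857264638112020401300235936244321891943043616732939300635139930637701,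
  9427031531848910494487196860308530211167491478771516111498850736005648908869337374647261792467270428725997602955322982293931705803398242387552369354013839055561165979772311938614804785618552239386257192497559200941798920,
  16992389526387442491794050743966972466776491236804354224236901532399214938063811868943619374681158661784729195955851296544265548963272112479895401447147196904246881768034190002270148005197415194721684409428229663548049032,
  12432751672791089129634908815724965556432924756882962716492165941622298995941898629840787659212576151351959334666842703938794703854155594264553381172255419711322361093902885066123471074612661217466627597525649104009651342,
  11322759882515500826209212948972623394211506502276497197108363943790464911798067102737744604073056525803750647861725444796416075038907304259021070924575549347559185608628253325852440689040739323759271523659607753064145038,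
  7278726990387508708663018863218119431048034512752844832285776411682160056598799941876359264198796492103487976211159950784963337028190787585047515846316176816418410863840884338881906070912748464912337774576314283102471045,
  2054081608701324211962161396506550993055844838618262577674277329286426025390479088140931814148218442678685945905387502343209635147826832852948453374895827735663130656054863931171984665295595436624940863561319773707445893,
  3363136874118238207833850712235503546464318732724757591388144741818891005996965800272763247900942842933825427056420210460246312132824709400357074843391382054433253327193038075269469292273653960937477167601005575745173256,
  6177171647701959755089699933383164713098535682940030837774006913996025093291549927442630114564041619170706265624387410589175063129573551317361172379220951155904899705713789365505541265490666731308162585468505381874902542,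
  12335852430433268282991295933884923718121565537104543118576735120227258046102184992030649114436133221813768990106663179030949792613609074570164071705254297480425040308173636384108465965274818427685584197864873656661025550,
  17696652713797720689905106821093230983044561901910981187859700339510250780425658942649666775311559982317476875316916256800556707808486607499244391512582862193615588466928166313480134089786900589303401678950105703243796741,
  18401843336305896009713838859085955336708236152449883690604759992556098629444964643661756860557424700982722992503870557439075349166835169912148263230942913169840555154882968175448993144995328329160470608504186617557087493,
  17476030202115692793063071376984540053833740173345113896446963578609183407067735506751066847840060522949423116836770572269927076705780762017945431356599778588120726940361768208286964666088084452846485045874916684902864645,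
  8939078557618152899224717975822072669093801209149779223566037327015506901869857679877531321529275707754100888238720400463844301294282959142906287184864500151754191364936037084334870780121620473776667045441354833175385870,
  5487264859298178035772581546869435997513166070237816185129534415520584693539383216405122359250319178399532116519882406599341884430424390326685349558753883348476330835448637636613987241466756822215028082165539965374571790,
  8811849362534778598215942103307656985495965701340704260100597978048742022136579534448992306321134635046836303924350761815114714320071216931469230599751037797363284854702528918086943698106844003254758915780543833755361550,
  18684680662893739441965619815543373664552668437634975102664909902495695446232056165245442273861127768861711583984662024301450600795425522859204137353667662119960191698812406875332649071215662280093080199730624458444833541,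
  17504128774040624507017721612176422666617755045580794260054720500637554400195388237533488207437741862102400123244243576114305871977587879989805732187973034248768107384193214507150947600032450169239766034909852123699504645,
  15392991628880888676966687401260257815415072847046900505334352484315888580311348846932201747521701730610614736203090283658388090055301727342214752986734586455089751290472785306018030330476051993177009600634616910321157890,
  19108692890450796917819169437319004803738671722514598561377960889705182389625978015556251722759147728354243459297256667769132374512759833127243526794428391567125274769273541906308716770484526068077993115219220693752690318,
  6107420220646536249457099495713419126088258455550422480952399879980527420556371371326264743588481365062362951580967836465939807903927301459893083495308645402569043430555600023247305987967480175304889557369335530764104590,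
  3427689325726612088933070049688329043973450916212466750854527683011063951361733872564149658763779305255579309287044279372698777108458721599416775137595925045554423431077157915467850439408031563223058885831928877831737477,
  1833902886173180601872978039364592918664587200742038534700082705489870723811414466683344906178471967245671083116717306813244439984879873282574767255783615707711636030024767216459815899838952967611289162103950506927555717,
  7394912137119475333615934979771823627114323176033515511288099380407037884025486599200229968406731372754213467061867911401491975707492557544891320221489678203422629657230485057012742530168983600961437238959991902397539970,
  10909398863416094209644088763336815791639831939917665045398844402634522681863388246312917713477727358149760733562260955233476102679758336714765992588608310118770221381071225214425656455075656496794156097581090535553783298,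
  19362257453317854280217089977206630119201093341042148273461610534629251825545552823730665785809370517587702594426984497046448018272141928359024555374809066046639304328155253530050359916185318069036038643362138491993990542,
  18786106291715139735587681725818706228904283974087195553352794116719887771657061400219734913488673049276954000437496993382597962807690052312780908439055758115178599495597140376193763734975215466000061199143915863942373774,
  9535206959703929103887930538247792436118755387218318330361086627051522593927801800554184310541763398643058536145834223629784462866151286622778246939582521218163438804725681018443393124554130402842521835591224035822281349,
  19812605166013982213771038122603590285664122931485346924174428694780778183206338387425798360155106540330755462099394972225664452447783853731364569234349178961795282613859155333606251053399747247876875487795575681642468738,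
  20522800373425050470139859980510526389118117863544081096371544506978075542250030598172281483197512159410803188244491024721737964016856601106057423094621217677801702889307654204406511587870623984889541576701052007518778626,
  18224553546003760662219257756661692191127347441997206422996563822903837758704078282179692133631016166800431363370425286014090252292268110238785545892899374886892581414267550295544460183332330889630003919614939406482285698,
  8091828278697170453961487220340168848626201227917029752325098706306657832174728200118221824373526672593158229265388679310733922045515042790883945865751045115755552393948242305391264358639981437365202018587600585507226638,
  8037816016882536413687112597329976725083196763387857223879731731541998738270412798507268915306837882354657984522338394986322514772676561447830048577976903291208269905734816997979136757882277783063180098027308947447750661,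
  21228349976233222536016805869973848499801847515421943466585587589797451971359537307558014290994760006864116820847981576015364825650622522928981734001786532729471530418521316779386632627797584654385083328637341662964622338,
  5964789042541552865708296911806245204864194002709481479151338170324566962352781753876177076517544355871178910245281685040450147096686912510054757506778200607684535026618247674360883149008562570169124498123770889049068418,
  12814150857778748952175313008296199316558448001602169138906578306051296092770285517412212674110220247409877697469622466796481880750923190469663028080779684940096575920546198449085123089059857435608531875222713278065550082,
  13479603368364798324256197298814151739070138792332351217573291670851221763182672085082812520592378492054163259280385358433539809024286597020985817870564808531834416382300908042496048862362102689808847064963193182433514114,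
  7199976996188636290044823999048091891623173832964061742316481416299654700012905450181847466806060618238101782584793035451294990700538440352734173908805221924522360621849870031927696042805412959420169868728860652844372494,
  19467802184961504497205540810546788200323578233852980412676180487614140406726548680186451799592745498832343791186833446431711273272705096495667594804570453773128314000827753257745043920425292235439911605480627503003410946,
  8734780037736743721861493012372783976828446356289113521820104168191032362508663508536051576191931012559537533839668147137329385013098492492181233948852638593475994429606344832424414533728454645863347507231976107033108866,
  5430167818855842625282014114263896299204099044848683011026754459375381243970337038004943366751645806564402724707601731502358877907133274767004125553404363582488212662996724882998083522207181596660488282243265687925760258,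
  10623327022199889747647504539903982606336738899038953567955835137320595129847606280757900683212576785211719209033196130647479761501939434164170860190683282507285781214412546336775906043219887842134389849555979228340560002,
  35684089646348911651573869522677346554274964584895316333862662549157379500158036488727694050644824514677174525139268215698489899517357163656713657055721144719102071198939911123958038245632685694033125993714549247188994]

/-- The entry `k` (20 bits) of the row `j` is `i + 64 * h + 8192 * h'`, where the `j`-th representative,
multiplied by the unipotent with entry `k` on the left and by the icosahedral matrix `h'` on the
right, is the product of the icosahedral matrix `h` and the double coset representative `i`. -/
def factorTable : List ℕ := [
  6663558085114540680469793892289792766946708176575536087061645374362076325554572944646003698112810815790451119026236166014254502615744795801744085964177565857862854638210851412753401321914995984170520035381127515295140769706518849477057210494257769342417338961180045034653494105159121642100176917247190164646666720645570939449351691713608269031435022081025326972928,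
  13652819273237033673723047691404142119909745908421521931397341577620134849769702920458443425414764779680310441766623865889229508076798032961656966392941695239389274556691948860060314122930061189300890513662607850035719580077230056503475365316649850411045482145896588959883278789234754810343347769174420989398494983272419768996917327375216208188935871014412230084833366,
  16312967439127506551297850410631176181801752194574293326911164188232614306662612815025515810983527616409533558721859060725731824034169249421696111849099739776055458853843737097415059655609895225772781703040706595710340539293348752925053658198912345285335365807420963130788333456431599771022831911667920279817412138009409466981311877416535473423206214276925682066002515,
  2349624239315933882503996674868488097000143790137441765210038198661223064896087852808764977567027222635858747930091824092169088363449407458126495383734955710585588258642019624552692830612491738081850337034925057904331659027675956130283005504183635919863231337329319860969769033303253920747817416978446479784222996434295216841995349607856866903545328143265542944545699,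
  2384859112553387674285292071995395112004751409500448420998095529739631533942149459143968767187782077432708435992278277135294431690394522360939213505977626151678620632278489280811011738613386240188789086593816621612995487045068530244829572416085483806236188248848754758007550735721822406467579037518715279055971842168418695156516344693673691079059583915867054742272539,
  5231622460431517712200890582409837982291260292817903344999080981078857790850199038160562614669129763160998982235594908869686667004170629303666897282944406312508389512006187394569426631830543486042983356362685616326517067423260955576212515297701050147866273356467576442865005815790133662826030944891980003477629047535685102423736521584490784451160496042602154697489232,
  10380950654781651135570932237698923351618724088818684621243267919733000886729648138046377349355746909211997958451177038186431732206151623026971377315978710060212404555830454759747905234586470503054447710881108178778616484558732484817492390087158934839273431344289114186691626737567352132040515288891828994295558257398829410193405873264604614855710660260211443722571873,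
  908183257765082950549120515582617738976474564502505373653208657722177560302256411079663959897983343354138016699639906972620642061005857562942892492883704443562124245113738484368684532436406304523746793994780812794307518758579753245570848692802458736253349083189767296448656709322423610273065056116795884922656961670247506504177570017250743232833808678799010566564710,
  11859103246427319368161191624453231618422124020075242960607360656080854425730218858975871233748508129977125061292980096019998078826472427906683472499184606459201208819724156334781420853028761502330931711212049213311857091197491421275834206765867238266595644313940715781511515641315582490234145205728192636686955751565146472920148073963483299699718471330298817870971417,
  13952500625880131453206570177087430448682154480478630705273852443240160980725370277826534341777338014009346411884929585883743550904397514842303744294613458668314461039458531772764878563322257074932161372085856001655322967661822168736266375719638514391481478824808577458770166019143646773556499198392064636878670206213427758752206452243010936459925367232591872708508753,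
  7738617410504009583879297512346459706919203202791798862373704827157368782842682699622268036655166611911043394340302589377051828421817526066247910253023389661726361593664895909856053251237845407899320396099518795949574478759600130390355303799315869788705057477297305581288668359340483866480358731938607398355705519252093489796373778021241680349310607180499877632048273,
  10133340960038669101800571985027046985682596005723022118240824772811763030108493283101531578928143951753392617814923807945371716890121947157927847263819389778282933351586489336226286787510674055810364166366823758367985402882092824340250875963966523002342602806559575975571302715234839579331017505824435454035098404188770284919994585466706460347322428723714809827945827,
  12364530253650422481450691925425964585453720181139155400394774073492647821282329901653301904847060254239937058115930111694886633042826363543294320699727429561577760958680909930636321805557215067667927190032510127845589264609250277286910149172939353605772205264632204353055652006099843988053494139570306732875138982638344658435899110849255064267546329396873473248364386,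
  7593007559929482806647110763588394967378860780642281247180911266612629167906218016236784646750775728567482901803713974542769405797580515470407620251733301665653699287721667144699166245599744314341615253188785677276293627926116056273894176841336513899790685599752936158114192159704195151145044961427662915380853824396660716153327147673163112840472854822110107878067539,
  340026584614792252808599086935547310688039997199309191053214644618996709163155605468288133765902041898016040270638392968480089552828583691032312720119595431767073909150010350478758121221748863747678814443824380043576655503260778797906045923721932671800079153710875474157563183806562327452706012711517521166136306591158628966795657536946401195961992533016904302751574,
  9711042210583079889950747054066368029681901954790858968792353542036815733555719709628635437304698849664595293743494382369129058726404555594615233744987632128861832346781213227542348437957749878232646645327876871452907434230576147783405196457943405779584014901754657920465610335518260887637781409003890560295250636402419098419868611475275961420944380815957407189054801,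
  7711150810040329418143851992919476727728304002515355149104768069073139649642127151640185900953277640889126562818190634871908094633318235883604406739472603674085127690502472083845544571152111245006112673030188019931506790548642759354784919672737906395254999462097897679979632608675516492286807088524472787369734266341996314847930480173720928882827507648949356264713435,
  14175109260142530861855842041905337903720555664110604451676097662472254703216032528997294101362226524791314671084774969825718348984398696611030587851883137923380738496690269257614075026676467236227574054888260754656204754700280498447314114343560861532587336439362946489951113771046706199411722270190313652529720311456337930054795988421365570608992095029814534183989398,
  707769855698171931007266004183590959569045117526381954302731044897707403594932511743597444219324826840175973957959123305559789590649932680181386532045127200931078192992017780173984000837338819560220232246005420655244595665142477058860880871018443292880528228500218313731172674640938058917270059386388338070101710855135018797208440215344443837095867711497681890222098,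
  2619871451134508758453795188242991227268445277643828407507325245382932254371643321625565619710340828472066731639063455439524569079371772833340893541789911491465581137825527681552644913640605732407805250555028826970557298191361200125406779985126628037235424492118261789194780561716618351231872344113858947386653493945674437500678027318748729787836369202107130036887634,
  14092451049094673141718557557567423265738326498775419360634450892256823180498847115777974141219233072160202127604642500871700403873379853638089910966983272495178096104284960923293225606081289205651689980505861504770798645712324743402180103851533283515987380538080725278804356700854102956654138893380157560907974329431707270503612937368335806748480217667288538933560478,
  12020014511486536535693002493557671885950279000122880758387065647356347708352512436838193579189870283101683109764123262307935668530168874335724321363770987957791755995513520355656943673119204020812537770313108566786255646250440326189528014210340000776286496224370258358171446657701511748315488507641370621608610092976734957814320380090855324979640645797197372174427749,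
  6243026212039562156154456233908635680923146244177489693802314538242911339889130611831416244971572196262222577092738902642130998743523688688370932172770832532536546267171577164262317743650493784032361934669581481004126516978641145812062840271803509323366644239178388564237522725091181521308060350497186299360573749332805783054446545621482748840219980075037904933107982,
  3955611159491987728395085322054939330326278365341703329882450622249839508716379823007739920050161086283020368516154743998585606615943426337760013121865155370845214617641112280120790072787311387876027802447638252613379537849721321303710148550077611071931706068338207760128497717117924901063308376093256205687574266705479523294904540310792307704234956216717431853505744,
  12523339189369612644294036881158525534756817893326176689506787695954049048504976564621985205171305270332082667860353910974625870412841639216107940147912802276116979237508834846592000459383314866307449009097170528633674180618774943624685274799862008242979933680654170098871895236482763171160486706348101889198545985396067515600207173554583223539573144512741100855429541,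
  923619923960919260987886617553465353278921483642273205270568895814732986739993698629830896374612538592440721563004199539747641691481960019313213403730417637996109048838312575449877434589144420553150526108490437329699146582799427071381459254835880829594529921902697935308942586954976081634349045815641609702085702398065547491102506871494621225930293100396139327751968,
  763088711714696274675629679625740783039514331587732428312886386799453798097652197484203401286889469067822594372242092122231401764410949805126971509719496040123598708812325921936586866094270109343790032636481262105387724377580016274693497223073055523841542605418421111991524960915480547474059710210752788138916888783144168265975817214057311303283928875633137218312913,
  10133101987844201351018361083813627578108477276805173390798995944302065505029218806748847958686559694089008469092639921929678357843030576962356885217639308951268673839068562012416764171792936742638821381637349043892244418923712791679479399840928873217790478666181570405871863118762085465746010489571759657517099207477707472717379374491020818404241693538350887180801935,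
  5242719743033467087307214840567567958175463260559159309064387206082574970908395596010903108786893669463997832840401208159815618770508875465521132359561811577570967468162950332735773368665118808890907978808072773721184753220134272327059137015057070132177651667436163469715897482688897631257435011291124628888044040572671054188367086826229720530114818204855644649572828,
  10279779147752389994876217592451540890923180517867065212524497644141514168099305304752883296243783469937774802321646275121275110267736230372340714294363800938797565798170774986769550113978764913137283527182036371899571279569037550926361420187299509292029915884800250947774928634834600077515097140685173729635591142146303182123111339761591824843359124592842853869729372,
  12519069002198015168445275432386803102501987008955638507777421885605095699536594474918413739449665477684468481405596655211005000812779230977397439211048006762211713269328727711019684895551127530831741900618841155892429140949794955695257849957903066942366267043828930193572510862265425174434032629566965621785677092056909052255205585723836650341077473280505682165078855]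

/-- Closed walks, one for each nontrivial double coset, through all unipotent orbits: 31 entries of 31
bits giving a matrix (24 bits) and the icosahedral index of the step that follows it, and then the
unipotent entry by which the walk is translated after 31 steps. -/
def walkTable : List ℕ := [
  619672751345708670044644830876579504840513527967889664337868781752142361927223649323714846713029954526867983209593786731453990637534153886554707583902930749902289281145538472160498456035951026581731263983574286297571420013041823389837626258439297710086798237149994229842558196184782727028540,
  101460843996503620808748077799050901625455427119499718467094652524614616127561504579451472716342228365083491670027502182153542720516756810177833270202233821347349397718261673516090854710467388714193078685316480602256432431868487859397804271963070743495311898646796177923521596373638473821712,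
  117926984080631940426094784371026631341344923403440672268407640860864966757771918412753730858984111064435469302791946098448460012233748474253348731692099642330234909907869322180354795368250313395297222930674200616488689233690149279315203306043962929736859375259094309486408371420997851873541,
  493319771682832948548137070321853745779201732500144698599139230031102500097933218057571244341040050443869296695652471996192968989350671322794899279561857701443288875749778617565657852525356929165646386034567992493995554643269181811304897334818068663999476873095067934107181419724550938766135,
  1002989893697909100843832558055411140956255726079918979367905205952038066372004683429115794481942561012642184110367688873777734244969505897790439179731725483487305743955173580432217777091542494612296345595305318549765419170393374832386861497833796130187760713257760470113765362463274883853840,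
  538721022372494244539327582482153662092852745035466454692222603724275019943985139425846322783887237903784648425061254506259256651725420109496820573762249972812870962519551873881230083156725840661277195762727944593036697714022384845115057884607989676267197693438758988734831698953814357475804,
  673822232657485305569817669112528028544514771337928319374621660507576434154066944040500438364266742763734004160276376828082092972776296945279289714576683247913709207143283394991652570348504220332718630673484612174588542443537492857029233334433689683763220022483748571027440693881547328009744,
  420684085443253557914583538874525045126544613514927166496499195749208806684779835080192224905501220839881292280779528136323023031481508083795555169989188303034508923291824490989627824978251605059355746319495420337605044764007757900749801610596458364819029516937115259674800143310392071200076,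
  987920455741400109180773589781495752274942357443885937059816038259945736087795604570467034313407669103766659345071740954944176419228808043936117211877151075636588570407715551151287168210510674017840181480750255199145699488121055690764558700097942683256779118283108406075866883240952400629389,
  392937579298356405428034195415969140209558409707295961751116706654741704754356190894405184110749903493102173187282178552387463961547900137313447521393022325220281091229988376099286305790958232606041017213773594225585708514714991633977299600773827660074761195380711709792894393769332999679032,
  865736875162349871111755856308623448538490735966685022127541327138466343286253595632481439843287258589460865025808241586434036561419119961455205566773368531846688532174932906123077767897707980692571876731608078292874608121097145917001361803797521578529126368379169362945769890988621152099964,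
  827315303335294325382518083898095261471214988761458189123076964237585254130124750821588396196257597001930807131498576698465966924272375379130855683596114657232365433436200299181517237420159460264885472004745355904519890302528978122722340410872920220426253918525149879145770784625144710202192,
  517176549485528007869488465084152410675153048108041881864605181227779935830769626420206670209167627893959095959622966219627269437379009448619363845846377941405532964325583382651976805670579601082748244728598599480728120410549073100155944591882737705992558575506452481344316222673317735215825,
  1093205470565171308587761060019145521014229811338734156919891107677441857206019462985964472069306746426671482855182356022497726738213769826764498081873322913677112002906309183733436456881644643401491462600491873866505037232102710363775925114350795462221721925941625838264139052244526197808460,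
  920357617387206620933493996191660025590708141210132211916126044694614113795443030773622434359331409955552855842685362912291504871413821897886477929393618052760888829639628989068674404071985575369754789784809730098786950953328056858010857756351688988268709042457403979715045091513516168980998,
  1006885856204254346850307457445193820163015861169222525851742043725801288379566725154267129004648641780500923840882593238741744284959996337845412681667061129630125028211659067424822975136255838949967754143143368196632427965069079097737557312186001003436577277694344381608959096462483474701357,
  257444941429332999778971617904289945400441850843704537309725790098386534724565069405816103140796924217425564354872143650841180791873159519998143950623807680911360844018765913608262227570240932864311359136352224668202607465757329533513420771953119327124285662735175692462703325044116469907760,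
  58675294779857581679012167211298271955183646194795285178477449790204030085364838900323299588480937901080816732851936291064270331497858786647111348225866988261062924014246704478141243674919919100455853144690205745815762093462620412197729019214203059175836012725131614905478012704641697396258,
  346448333054670040370327121042926204848933166664035539067748665555793989540421339577753488440410370933023197239764766709272431791880231328768577570863088471502390952086051661589022699769579386284669731144110936609013019840151082436616622925686281357971359982582908873994939042217572400454700,
  1140876455645536393584613336773480221479019696500088380480667808919057196817623301166906938069664135779850547292538140769148749873072538170992401031037942239278499433478590920769215860086573718410588618973186044041375273342872138409493138136279708792234362525821875707635067880790260936524508,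
  81882190018650068040223907285684614117847183020967510208218252562687596524109575563981009364121625227093223712128754094995500863117644757222769125811893184728834567467407813502989495677157006451437963863236263608173256801219843718636677649394313677205269667984233195339872163961370872732716,
  1028205871279489295496813834942618581017990172353691961716907192931047069676280519176070229630006194284445571808667184385269970440221320276311012195557800225735273561813666499062281296416333426436645277925586210731451329568832923380768030043717345226735742450613741731675679470070392037033285,
  1021598117105047359335643301537665214990912402029881611698067268265716421060478138479343679918126043358279740038605938397389800667511221503278279222609097626859883377348990187364634754877906961599897239137438347032880044709071266314853649744968630171252786378636470039900096152348351696740156,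
  22104983689988248952315815688208717832266240005484826144543069029402962264607753321000577274349358480455573571828589293039966494005843331126627006539581384888723689373594535151481463668503280854001557724495226624680281888962943452980804588825419511575578803564414734543603357028639436725680,
  82274851126724656634275918421417095615538415184774183726413095278112208724160117703027648975157241627624085292880284039080170753056599070459527594739634050442588017078969521683196900521910736032361446840950324957409379565076519314317165306488395890195489252712554277727018838529239856647687,
  127988550429799720205222332656528824081140820990848991305186682995930136004296867942151945981023282959063483747969153840644551122918356887694552081234216147734819474174243643164593680782791408879757480719179581959026209992126714091123009469600036458089940321532680179864946427612792255188073,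
  1020288938343610926077782665768724976983862519075219784582871700765653074692667262850365654266363309183730866751852556119892298564457308232963014487792875375649011579697966338309666033984315832597603409190925655098448600852812422198872577873802755768040455954166675201833663132448148613264197,
  889931701100161776741649024146651399022642161221015205831014324248194546704714481894436142009999278039838819385177648363721696333815843323525710197282188249769600084683454020507245291786090106784103790998913358372851711693917010425089012696552514182898899774655675037419835951610654070287717,
  1006823502610177530078687791090667295184747067106356109359416728250731876169005456630991771236924590282967290134954773232584076439126670573709633754791839817073256942190323597091713156113778439506565298529488346019087105950342701621369621681197783522992808409383467323225617298464054156402119,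
  274397022867680419894443431098876578988872530941127598625765150713670352952801163551296616168935024937145912035343851965293908298538792530306956634206194346689397025709052338776488754259528604147889846930939485147894930868002750411391147426946919745369137803759853984061993073481052749241799,
  216004660356809640341567167221026948157539776509443053709864536750467486945078585266965838860889363865547579704887222033693340058658667378648119638953858981623668491140559999544590744383119538188260012146788616572917693059910838943051475533408670438108502566303357367788190116877872863829208,
  261468781962358834490425559169718684062126302824962608787904805015362669551352442536296840011941017301147919112409653359756796807106181204330570891339652674497222027428258645433808406775658677189702173572754645465959844307230928849357769882676049667009169097099832996846413750184470750394099,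
  755631106165532632617913967212710315765813984334018290089706621336993771774573926607717797507137235665073277691537509680118758944642154226700112460344784982918268691953652686235249427899290184753049671611769816253813345374712143955959507321576310718633433870671974376070599202868040550063932,
  352443609151218900561140149950430352791089618065599999156632948831783976302064785338355810940491400579944236648280164192418309996515204703413602457672338976756454529685643912159901235668294931411638940812721523283973382151051119028951150748547839546183759014825752229323786159366635217158266,
  968530512936095918624244496536391157881247040796055666961346314261852930943359293840400791399692812408800130099201009275801239171237524312675492396382387697400858528573312687457540634934524126164475807608881409521128959915590864095572287955784506845488113313177313235507368009024610776167494,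
  441835279106555974318056576043624082970093983904910810757187964242369607609026829852595798494972599580175787672636032642046186609698614423036983183489998618404641423771453581540729231860162050219636502792012775412202610236420484292383224981261774006062143656691923406298820459710427222748732,
  129720982948341162939688039481053426308536538087171754362719143759195654101766500535893069106824445129475609789769833115895527881007870752575649898503553501863772298054712298173051865751424683000743773331641718333173600067404829584038063554931370580683071577916678648757264203348544234467693,
  704213834838438023447603548838679240880682289895321771173269842743297380017940243352405154923605096604083919455206085079695518601838230911054341256119379458640326675869442137817238820819868621582765179193315623705374814570807352107217327552828666311073546851837474389166012887396803503128697,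
  1177582438664853339596800109672444720254004081268040030307108186614663944539886466011385567134166968078663033077164297501746875955193172806959687888104292600872506959638281066991979969835321964303665854294459360249444827172087104024309844502807954926597659906813275290498733327116097265946082,
  907524620116612763788811346180439206648115241500154621866826132162643342926778101423526479152049981025559532896173615350023432742282643747520253854801132948159907921424497262125702089957724978083398800896758770756519146598769053827509200620219710147959952387204844014755097195967614791520496]

/-- The entry `j` (5 bits) is the position at which the walk visits the unipotent orbit `j`. -/
def positionTable : List ℕ := [
  37807960227546690375624649953237815615752915008,
  12077069666440381834470595314349094847032286720,
  36380352158575890873880869561292041067326469056,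
  24761007204341927389413388997659645422657290656,
  6852900152524881117500624209948171127773454816,
  8905827778465745496049254212789193521211701984,
  16307175032794565587404107939778404688560626368,
  11070332460489997931693014446618707729988420864,
  5878820002468218194945852844680684163886051936,
  17892805065897269299268048473109922088205184832,
  38750738065015822000017960746414990948336339488,
  20841520184296012682061465261615488818045883936,
  9787954924464863258147736352744188999726303936,
  39465036535352171032245634850881716718744324448,
  36097494750386335937406623414094089530023637376,
  32427313101235729668185454551225136877246329504,
  30312401088373675768860200081663264767150185824,
  33070714844592845379854292131157113963918258592,
  14354043601443162220708901529942735585415199360,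
  6751007460313505943164679238274313347828836512,
  8623865028103747618325879627195847421175454592,
  23913925385775113916389347023651496144233278656,
  1544816490574667146465545393265468091871905536,
  21662447771079780678685959342287868447429391936,
  30086855967802706390101733638970777790083660160,
  30584736399002440715858481216202165667600855808,
  34506940319639233618419458511340874163005736896,
  18039218346823444693995892875968112639943175776,
  15993444629454963536039005019929045244296111200,
  23763658422787011487332406151019782801376557472,
  26396965853952714862572164615528640246773725216,
  20077778567911657943791485352607033799858610432,
  4540906011620551648202304469649572284736387648,
  42897809362167302638694390785804981254205708352,
  34409506008387830759253280418815156949766893504,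
  18868053186257998125335621731897911216213744096,
  16241203777438124077404146944740160914326906368,
  2757370043214882783445693682272313722283941760,
  29162121191261006980781338400360496236436045344,
  8483563794217470582007416765785424955296954752]

/-! ### Decoding and verification of the certificates. -/

/-- The code of the product of two coded matrices. -/
def mulCode (m n : ℕ) : ℕ :=
  (m % 64 * (n % 64) + m / 64 % 64 * (n / 4096 % 64)) % 61 +
  64 * ((m % 64 * (n / 64 % 64) + m / 64 % 64 * (n / 262144 % 64)) % 61) +
  4096 * ((m / 4096 % 64 * (n % 64) + m / 262144 % 64 * (n / 4096 % 64)) % 61) +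
  262144 * ((m / 4096 % 64 * (n / 64 % 64) + m / 262144 % 64 * (n / 262144 % 64)) % 61)

/-- The coded matrix has determinant one. -/
def detOne (n : ℕ) : Bool :=
  n % 64 * (n / 262144 % 64) % 61 == (n / 64 % 64 * (n / 4096 % 64) + 1) % 61

/-- The code of the unipotent matrix `!![1, k; 0, 1]`. -/
def uniCode (k : ℕ) : ℕ := 262145 + 64 * k

def icoEntry (i : ℕ) : ℕ := icoTable / 2 ^ (32 * i) % 2 ^ 32

def icoCode (i : ℕ) : ℕ := icoEntry i % 2 ^ 24

def repCode (j : ℕ) : ℕ := repTable / 2 ^ (24 * j) % 2 ^ 24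

def dcosetCode (i : ℕ) : ℕ := dcosetTable / 2 ^ (24 * i) % 2 ^ 24

def rowEntry (c d : ℕ) : ℕ := rowTable.getD c 0 / 2 ^ (12 * d) % 2 ^ 12

/-- The label of the orbit of the row vector `(c, d)` under the binary icosahedral group. -/
def rowOrbit (c d : ℕ) : ℕ := rowEntry c d / 128

def factorEntry (j k : ℕ) : ℕ := factorTable.getD j 0 / 2 ^ (20 * k) % 2 ^ 20

def walkEntry (i s : ℕ) : ℕ := walkTable.getD i 0 / 2 ^ (31 * s) % 2 ^ 31

def walkCode (i s : ℕ) : ℕ := walkEntry i s % 2 ^ 24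

def walkStep (i s : ℕ) : ℕ := walkEntry i s / 2 ^ 24

def walkShift (i : ℕ) : ℕ := walkEntry i 31

def position (i j : ℕ) : ℕ := positionTable.getD i 0 / 2 ^ (5 * j) % 2 ^ 5

/-- The code of `stdA`. -/
def codeA : ℕ := 13110731

/-- The code of `stdB`. -/
def codeB : ℕ := 270080

/-- The recorded predecessors form a tree rooted at the identity, so every listed matrix is a word
in the two generators. Only this membership is needed, not that the list is complete. -/
theorem icoTable_check :
    ((List.range 120).all fun i ↦ detOne (icoCode i) &&
      (if i = 0 then icoCode i == 262145 else
        decide (icoEntry i / 2 ^ 25 < i) &&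
        icoCode i == mulCode (icoCode (icoEntry i / 2 ^ 25))
          (if icoEntry i / 2 ^ 24 % 2 = 0 then codeA else codeB))) = true := by
  decide +kernel

theorem repTable_check : ((List.range 31).all fun j ↦ detOne (repCode j) &&
    decide (repCode j / 4096 % 64 < 61) && decide (repCode j / 262144 % 64 < 61) &&
    rowOrbit (repCode j / 4096 % 64) (repCode j / 262144 % 64) == j) = true := by
  decide +kernel

theorem dcosetTable_check : ((List.range 41).all fun i ↦ detOne (dcosetCode i)) = true := by
  decide +kernel

/-- A code with zero top row stands for the row vector `(c, d)`, and division by 4096 discards the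
top row. The check carries each nonzero vector to the representative of its label, so equal labels
imply equal orbits. -/
theorem rowTable_check :
    ((List.range 61).all fun c ↦ (List.range 61).all fun d ↦ (c == 0 && d == 0) ||
      (decide (rowOrbit c d < 31) && decide (rowEntry c d % 128 < 120) &&
      mulCode (4096 * c + 262144 * d) (icoCode (rowEntry c d % 128)) / 4096 ==
        repCode (rowOrbit c d) / 4096)) = true := by
  decide +kernel

/-- The three identities are invariance of the label under right multiplication by `stdA`, `stdB`
and -1, so that distinct labels imply distinct orbits. -/
theorem rowOrbit_check :
    ((List.range 61).all fun c ↦ (List.range 61).all fun d ↦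
      rowOrbit (c * 11 % 61) ((c * 55 + d * 50) % 61) == rowOrbit c d &&
      rowOrbit d ((c * 60 + d) % 61) == rowOrbit c d &&
      rowOrbit (c * 60 % 61) (d * 60 % 61) == rowOrbit c d) = true := by
  decide +kernel

/-- Every matrix is, up to an icosahedral factor on the right, one of these 31 · 61 products, so the
factorizations show that the 41 double cosets exhaust SL(2,61). -/
theorem factorTable_check :
    ((List.range 31).all fun j ↦ (List.range 61).all fun k ↦
      decide (factorEntry j k % 64 < 41) && decide (factorEntry j k / 64 % 128 < 120) &&
      decide (factorEntry j k / 8192 < 120) &&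
      mulCode (mulCode (uniCode k) (repCode j)) (icoCode (factorEntry j k / 8192)) ==
        mulCode (icoCode (factorEntry j k / 64 % 128)) (dcosetCode (factorEntry j k % 64))) =
      true := by
  decide +kernel

/-- The steps are identities in SL(2,61), not merely up to sign. The table `position` recovers the
time from the orbit label, so no orbit is visited twice. The shift `i + 1` skips the trivial double
coset. -/
theorem walkTable_check :
    ((List.range 40).all fun i ↦ decide (0 < walkShift i) && decide (walkShift i < 61) &&
      (List.range 31).all fun s ↦ detOne (walkCode i s) &&
        decide (walkCode i s / 4096 % 64 < 61) && decide (walkCode i s / 262144 % 64 < 61) &&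
        decide (walkStep i s < 120) &&
        position i (rowOrbit (walkCode i s / 4096 % 64) (walkCode i s / 262144 % 64)) == s &&
        mulCode (mulCode (walkCode i s) (icoCode (walkStep i s))) (dcosetCode (i + 1)) ==
          (if s = 30 then mulCode (uniCode (walkShift i)) (walkCode i 0)
            else walkCode i (s + 1))) = true := by
  decide +kernel

end PSL61


/-! ### Hamilton cycles from periodic vertex sequences. -/

/-- A cyclic sequence of pairwise distinct vertices, consecutive ones adjacent, that is as long as
the graph is large is a Hamilton cycle. -/
theorem SimpleGraph.exists_isHamiltonianCycle_of_periodic {V : Type*} [DecidableEq V]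
    (X : SimpleGraph V) (N : ℕ) (hN : 3 ≤ N) (hV : Nat.card V = N) (f : ℕ → V)
    (hadj : ∀ n < N, X.Adj (f n) (f (n + 1))) (hper : f N = f 0)
    (hinj : Set.InjOn f (Set.Iio N)) :
    ∃ (v : V) (p : X.Walk v v), p.IsHamiltonianCycle := by
  -- The standard cycle of `SimpleGraph.cycleGraph` lives on `m + 3` vertices; its image under an
  -- injective homomorphism is the desired cycle.
  obtain ⟨m, rfl⟩ : ∃ m, N = m + 3 := ⟨N - 3, by omega⟩
  have : Finite V := Nat.finite_of_card_ne_zero (by omega)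
  have := Fintype.ofFinite V
  have step (x y : Fin (m + 3)) (h : x - y = 1) : X.Adj (f y) (f x) := by
    obtain rfl : x = y + 1 := by rw [← h]; abel
    have hy := hadj y y.2
    rw [Fin.val_add_one]
    -- The successor of the last index wraps around to 0, which is where `hper` enters.
    split_ifs with hl
    · rw [hl] at hy ⊢
      simpa [hper] using hy
    · exact hy
  let φ : SimpleGraph.cycleGraph (m + 3) →g X :=
    ⟨fun i ↦ f i, by
      intro x y h
      rcases SimpleGraph.cycleGraph_adj.1 h with h | h
      · exact (step x y h).symm
      · exact step y x h⟩
  have hφ : Function.Injective φ := fun x y h ↦ Fin.ext (hinj x.2 y.2 h)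
  refine ⟨_, (SimpleGraph.cycleGraph.cycle m).map φ, ?_⟩
  rw [SimpleGraph.Walk.isHamiltonianCycle_iff_isCycle_and_length_eq]
  refine ⟨SimpleGraph.cycleGraph.isCycle_cycle.map hφ, ?_⟩
  rw [SimpleGraph.Walk.length_map, SimpleGraph.cycleGraph.length_cycle, ← Nat.card_eq_fintype_card,
    hV]

/-! ### Matrices over the field of 61 elements and their codes. -/

namespace PSL61

open Matrix

instance fact_prime_61 : Fact (Nat.Prime 61) := ⟨by norm_num⟩

abbrev SL := SpecialLinearGroup (Fin 2) (ZMod 61)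

theorem val_mul (x y : SL) : (x * y).val = x.val * y.val := rfl

theorem val_one : (1 : SL).val = 1 := rfl

theorem val_neg (x : SL) : (-x).val = -x.val := rfl

/-- The matrix with a given code. -/
def toMat (n : ℕ) : Matrix (Fin 2) (Fin 2) (ZMod 61) :=
  !![((n % 64 : ℕ) : ZMod 61), ((n / 64 % 64 : ℕ) : ZMod 61);
    ((n / 4096 % 64 : ℕ) : ZMod 61), ((n / 262144 % 64 : ℕ) : ZMod 61)]

theorem toMat_mulCode (m n : ℕ) : toMat (mulCode m n) = toMat m * toMat n := by
  -- Reduced entries are below 61, hence are genuine base 64 digits.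
  have key (a b c d : ℕ) (ha : a < 61) (hb : b < 61) (hc : c < 61) (hd : d < 61) :
      toMat (a + 64 * b + 4096 * c + 262144 * d) = !![(a : ZMod 61), b; c, d] := by
    unfold toMat
    congr! <;> omega
  rw [mulCode, key _ _ _ _ (Nat.mod_lt _ (by norm_num)) (Nat.mod_lt _ (by norm_num))
    (Nat.mod_lt _ (by norm_num)) (Nat.mod_lt _ (by norm_num)), toMat, toMat, Matrix.mul_fin_two]
  simp only [ZMod.natCast_mod, Nat.cast_add, Nat.cast_mul]

theorem det_toMat {n : ℕ} (h : detOne n = true) : (toMat n).det = 1 := by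
  simp only [detOne, beq_iff_eq] at h
  have h' := (ZMod.natCast_eq_natCast_iff' _ _ 61).2 h
  push_cast at h'
  rw [toMat, Matrix.det_fin_two_of, h']
  ring

open Classical in
/-- The unimodular matrix with a given code; `1` for a code of a matrix that is not unimodular. -/
noncomputable def sl (n : ℕ) : SL :=
  if h : (toMat n).det = 1 then ⟨toMat n, h⟩ else 1

theorem val_sl {n : ℕ} (h : detOne n = true) : (sl n).val = toMat n := by
  exact congrArg Subtype.val (dif_pos (det_toMat h))

/-- The upper unipotent matrix with entry `k`. -/
def uni (k : ZMod 61) : SL := ⟨!![1, k; 0, 1], by simp⟩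

theorem val_uni (k : ZMod 61) : (uni k).val = !![1, k; 0, 1] := rfl

theorem uni_add (k l : ZMod 61) : uni (k + l) = uni k * uni l := by
  apply Subtype.ext
  rw [val_mul, val_uni, val_uni, val_uni, Matrix.mul_fin_two]
  simp [add_comm]

theorem uni_zero : uni 0 = 1 := by
  apply Subtype.ext
  rw [val_uni, val_one, Matrix.one_fin_two]

theorem uni_pow (k : ZMod 61) (n : ℕ) : uni k ^ n = uni (n * k) := by
  induction n with
  | zero => simp [uni_zero]
  | succ n ih => rw [pow_succ, ih, ← uni_add]; congr 1; push_cast; ring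

theorem toMat_uniCode {k : ℕ} (hk : k < 61) : toMat (uniCode k) = (uni k).val := by
  have h1 : uniCode k % 64 = 1 := by unfold uniCode; omega
  have h2 : uniCode k / 64 % 64 = k := by unfold uniCode; omega
  have h3 : uniCode k / 4096 % 64 = 0 := by unfold uniCode; omega
  have h4 : uniCode k / 262144 % 64 = 1 := by unfold uniCode; omega
  rw [toMat, h1, h2, h3, h4]
  simp [val_uni]

/-- Unimodular matrices with the same bottom row differ by a unipotent matrix. -/
theorem exists_eq_uni_mul (x y : SL) (h : ∀ j, x 1 j = y 1 j) : ∃ k, x = uni k * y := by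
  have hx := x.det_coe
  have hy := y.det_coe
  rw [Matrix.det_fin_two] at hx hy
  have h0 := h 0
  have h1 := h 1
  -- The witness is the upper right entry of `x * y⁻¹`.
  refine ⟨x 0 1 * y 0 0 - x 0 0 * y 0 1, ?_⟩
  rw [h0, h1] at hx
  ext i j
  fin_cases i <;> fin_cases j <;> 
    simp [val_uni, Matrix.mul_apply, Fin.sum_univ_two, h0, h1]
  · linear_combination y 0 0 * hx - x 0 0 * hy
  · linear_combination y 0 1 * hx - x 0 1 * hy

/-- The label of the icosahedral orbit of the bottom row. -/
def orbitLabel (x : SL) : ℕ := rowOrbit (x 1 0).val (x 1 1).val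

theorem orbitLabel_uni_mul (k : ZMod 61) (x : SL) : orbitLabel (uni k * x) = orbitLabel x := by
  simp [orbitLabel, val_uni, Matrix.mul_apply, Fin.sum_univ_two]

def stdA : SL := ⟨!![11, 55; 0, 50], by rw [Matrix.det_fin_two_of]; decide⟩

def stdB : SL := ⟨!![0, 60; 1, 1], by rw [Matrix.det_fin_two_of]; decide⟩

theorem val_stdA : stdA.val = !![11, 55; 0, 50] := rfl

theorem val_stdB : stdB.val = !![0, 60; 1, 1] := rfl

theorem orbitLabel_mul_generator (x : SL) :
    orbitLabel (x * stdA) = orbitLabel x ∧ orbitLabel (x * stdB) = orbitLabel x ∧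
      orbitLabel (-x) = orbitLabel x := by
  have h := rowOrbit_check
  simp only [List.all_eq_true, List.mem_range, Bool.and_eq_true, beq_iff_eq] at h
  obtain ⟨⟨hA, hB⟩, hn⟩ := h (x 1 0).val (ZMod.val_lt _) (x 1 1).val (ZMod.val_lt _)
  have v (a b c d : ZMod 61) : (a * b + c * d).val = (a.val * b.val + c.val * d.val) % 61 := by
    rw [ZMod.val_add, ZMod.val_mul, ZMod.val_mul, Nat.mod_add_mod, Nat.add_mod_mod]
  have hneg (a : ZMod 61) : (-a).val = a.val * 60 % 61 := by
    rw [← ZMod.val_natCast]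
    congr 1
    push_cast
    rw [ZMod.natCast_zmod_val, show (60 : ZMod 61) = -1 from by decide]
    ring
  refine ⟨?_, ?_, ?_⟩
  · refine Eq.trans ?_ hA
    simp only [orbitLabel, val_stdA, val_mul, Matrix.mul_apply, Fin.sum_univ_two, v]
    rfl
  · refine Eq.trans ?_ hB
    simp only [orbitLabel, val_stdB, val_mul, Matrix.mul_apply, Fin.sum_univ_two, v]
    congr 1
    · have := ZMod.val_lt (x 1 1)
      simp [ZMod.val_one'', Nat.mod_eq_of_lt this]
    · simp [ZMod.val_one'']
      rfl
  · refine Eq.trans ?_ hn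
    simp only [orbitLabel, val_neg, Matrix.neg_apply, hneg]


/-! ### The binary icosahedral group, its double cosets and the certified walks. -/

/-- The standard binary icosahedral subgroup. -/
def binIco : Subgroup SL := Subgroup.closure {stdA, stdB}

theorem stdA_mem : stdA ∈ binIco := Subgroup.subset_closure (by simp)

theorem stdB_mem : stdB ∈ binIco := Subgroup.subset_closure (by simp)

theorem orbitLabel_mul_of_mem {y : SL} (hy : y ∈ binIco) (x : SL) :
    orbitLabel (x * y) = orbitLabel x := by
  induction hy using Subgroup.closure_induction generalizing x with
  | mem y hy =>
    rcases hy with rfl | rfl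
    · exact (orbitLabel_mul_generator x).1
    · exact (orbitLabel_mul_generator x).2.1
  | one => rw [mul_one]
  | mul y z _ _ hy hz => rw [← mul_assoc, hz, hy]
  | inv y _ hy => rw [← hy, inv_mul_cancel_right]

theorem eq_of_toMat_mulCode {m n : ℕ} {z : SL} (hm : detOne m = true) (hn : detOne n = true)
    (h : toMat (mulCode m n) = z.val) : sl m * sl n = z := by
  apply Subtype.ext
  rw [val_mul, val_sl hm, val_sl hn, ← toMat_mulCode, h]

theorem detOne_icoCode {i : ℕ} (hi : i < 120) : detOne (icoCode i) = true := by
  have h := icoTable_check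
  simp only [List.all_eq_true, List.mem_range, Bool.and_eq_true] at h
  exact (h i hi).1

theorem detOne_repCode {j : ℕ} (hj : j < 31) : detOne (repCode j) = true := by
  have h := repTable_check
  simp only [List.all_eq_true, List.mem_range, Bool.and_eq_true] at h
  exact (h j hj).1.1.1

theorem detOne_dcosetCode {i : ℕ} (hi : i < 41) : detOne (dcosetCode i) = true := by
  have h := dcosetTable_check
  simp only [List.all_eq_true, List.mem_range] at h
  exact h i hi

theorem sl_codeA : sl codeA = stdA := by
  apply Subtype.ext
  rw [val_sl (by decide), val_stdA]
  decide

theorem sl_codeB : sl codeB = stdB := by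
  apply Subtype.ext
  rw [val_sl (by decide), val_stdB]
  decide

/-- Strong induction along the predecessors recorded in the table. -/
theorem sl_icoCode_mem {i : ℕ} (hi : i < 120) : sl (icoCode i) ∈ binIco := by
  induction i using Nat.strong_induction_on with
  | _ i ih =>
  have h := icoTable_check
  simp only [List.all_eq_true, List.mem_range, Bool.and_eq_true] at h
  have h' := (h i hi).2
  split_ifs at h' with h0 hb
  · have : sl (icoCode i) = 1 := by
      rw [beq_iff_eq.1 h']
      apply Subtype.ext
      rw [val_sl (by decide), val_one]
      decide
    exact this ▸ one_mem _
  all_goals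
    simp only [Bool.and_eq_true, decide_eq_true_eq, beq_iff_eq] at h'
    have hj : icoEntry i / 2 ^ 25 < 120 := h'.1.trans hi
    have hm := ih _ h'.1 hj
    have hv := val_sl (detOne_icoCode hi)
    rw [h'.2] at hv
  · rw [h'.2, ← eq_of_toMat_mulCode (detOne_icoCode hj) (by decide) hv.symm, sl_codeA]
    exact mul_mem hm stdA_mem
  · rw [h'.2, ← eq_of_toMat_mulCode (detOne_icoCode hj) (by decide) hv.symm, sl_codeB]
    exact mul_mem hm stdB_mem

theorem toMat_row {n : ℕ} : toMat n 1 0 = ((n / 4096 % 64 : ℕ) : ZMod 61) ∧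
    toMat n 1 1 = ((n / 262144 % 64 : ℕ) : ZMod 61) := ⟨rfl, rfl⟩

theorem toMat_row_congr {m n : ℕ} (h : m / 4096 = n / 4096) (j : Fin 2) :
    toMat m 1 j = toMat n 1 j := by
  have h' : m / 262144 = n / 262144 := by omega
  fin_cases j
  · simp [toMat, h]
  · simp [toMat, h']

/-- Every unimodular matrix is in the double coset of one of the 31 representatives. -/
theorem exists_mul_eq_uni_mul (x : SL) : ∃ j < 31, ∃ k, ∃ y ∈ binIco,
    x * y = uni k * sl (repCode j) := by
  have h := rowTable_check
  simp only [List.all_eq_true, List.mem_range, Bool.and_eq_true, Bool.or_eq_true, beq_iff_eq,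
    decide_eq_true_eq] at h
  have hd := x.det_coe
  rw [Matrix.det_fin_two] at hd
  have hc := ZMod.val_lt (x 1 0)
  have hd' := ZMod.val_lt (x 1 1)
  obtain ⟨h0, h1⟩ | ⟨⟨hj, hi⟩, hrow⟩ := h _ hc _ hd'
  -- A zero bottom row contradicts determinant one.
  · rw [(ZMod.val_eq_zero _).1 h0, (ZMod.val_eq_zero _).1 h1] at hd
    exact absurd hd (by rw [mul_zero, mul_zero, sub_zero]; decide)
  · have hmem := sl_icoCode_mem hi
    obtain ⟨k, hk⟩ := exists_eq_uni_mul (x * sl (icoCode (rowEntry (x 1 0).val (x 1 1).val % 128)))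
      (sl (repCode (rowOrbit (x 1 0).val (x 1 1).val))) (by
        intro j
        rw [val_sl (detOne_repCode hj), ← toMat_row_congr hrow, toMat_mulCode, val_mul,
          val_sl (detOne_icoCode hi)]
        have hrow : ∀ l, x.val 1 l =
            toMat (4096 * (x 1 0).val + 262144 * (x 1 1).val) 1 l := by
          intro l
          fin_cases l
          · rw [toMat]
            have : (4096 * (x 1 0).val + 262144 * (x 1 1).val) / 4096 % 64 = (x 1 0).val := by
              omega
            simp [this]
          · rw [toMat]
            have : (4096 * (x 1 0).val + 262144 * (x 1 1).val) / 262144 % 64 = (x 1 1).val := by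
              omega
            simp [this]
        simp only [Matrix.mul_apply, ← hrow])
    exact ⟨_, hj, k, _, hmem, hk⟩

theorem exists_dcoset (x : SL) : ∃ i < 41, ∃ y ∈ binIco, ∃ z ∈ binIco,
    x * y = z * sl (dcosetCode i) := by
  obtain ⟨j, hj, k, y, hy, hxy⟩ := exists_mul_eq_uni_mul x
  have h := factorTable_check
  simp only [List.all_eq_true, List.mem_range, Bool.and_eq_true, beq_iff_eq,
    decide_eq_true_eq] at h
  obtain ⟨⟨⟨hi, h1⟩, h2⟩, he⟩ := h j hj k.val (ZMod.val_lt k)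
  refine ⟨_, hi, _, mul_mem hy (sl_icoCode_mem h2), _, sl_icoCode_mem h1, ?_⟩
  rw [← mul_assoc, hxy]
  apply Subtype.ext
  rw [val_mul, val_mul, val_mul, val_sl (detOne_repCode hj), val_sl (detOne_icoCode h2),
    val_sl (detOne_icoCode h1), val_sl (detOne_dcosetCode hi), ← toMat_mulCode, ← he,
    toMat_mulCode, toMat_mulCode, toMat_uniCode (ZMod.val_lt k), ZMod.natCast_zmod_val]

theorem orbitLabel_sl {n : ℕ} (h : detOne n = true) (hc : n / 4096 % 64 < 61)
    (hd : n / 262144 % 64 < 61) :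
    orbitLabel (sl n) = rowOrbit (n / 4096 % 64) (n / 262144 % 64) := by
  rw [orbitLabel, val_sl h, toMat_row.1, toMat_row.2, ZMod.val_natCast_of_lt hc,
    ZMod.val_natCast_of_lt hd]

theorem orbitLabel_repCode {j : ℕ} (hj : j < 31) : orbitLabel (sl (repCode j)) = j := by
  have h := repTable_check
  simp only [List.all_eq_true, List.mem_range, Bool.and_eq_true, beq_iff_eq,
    decide_eq_true_eq] at h
  obtain ⟨⟨⟨h1, h2⟩, h3⟩, h4⟩ := h j hj
  rw [orbitLabel_sl h1 h2 h3, h4]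

/-- For each nontrivial double coset there is a walk through the orbits of the unipotent group that
closes up to a nontrivial unipotent translation. -/
theorem exists_walk {i : ℕ} (hi : i < 40) : ∃ (g : ℕ → SL) (k : ZMod 61), k ≠ 0 ∧
    g 31 = uni k * g 0 ∧ Set.InjOn (fun s ↦ orbitLabel (g s)) (Set.Iio 31) ∧
    ∀ s < 31, ∃ y ∈ binIco, g s * y * sl (dcosetCode (i + 1)) = g (s + 1) := by
  have h := walkTable_check
  simp only [List.all_eq_true, List.mem_range, Bool.and_eq_true, beq_iff_eq,
    decide_eq_true_eq] at h
  obtain ⟨⟨hk0, hk⟩, h⟩ := h i hi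
  -- The value from index 31 onwards is the translated starting point, so the last step has the same
  -- form as the others.
  refine ⟨fun s ↦ if s < 31 then sl (walkCode i s) else uni (walkShift i) * sl (walkCode i 0),
    walkShift i, ?_, by simp, ?_, ?_⟩
  · rw [Ne, ZMod.natCast_eq_zero_iff]
    exact Nat.not_dvd_of_pos_of_lt hk0 hk
  · refine Set.LeftInvOn.injOn (f₁' := position i) fun s (hs : s < 31) ↦ ?_
    obtain ⟨⟨⟨⟨⟨hd, h1⟩, h2⟩, -⟩, hp⟩, -⟩ := h s hs
    simp only [hs, if_true]
    rw [orbitLabel_sl hd h1 h2, hp]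
  · intro s hs
    obtain ⟨⟨⟨-, hw⟩, -⟩, he⟩ := h s hs
    have hd (t : ℕ) (ht : t < 31) : detOne (walkCode i t) = true := (h t ht).1.1.1.1.1
    refine ⟨_, sl_icoCode_mem hw, ?_⟩
    apply Subtype.ext
    simp only [hs, if_true]
    rw [val_mul, val_mul, val_sl (hd s hs), val_sl (detOne_icoCode hw),
      val_sl (detOne_dcosetCode (by omega)), ← toMat_mulCode, ← toMat_mulCode, he]
    split_ifs with h1 h2 h2
    · omega
    · rw [toMat_mulCode, toMat_uniCode hk, val_mul, val_sl (hd 0 (by omega))]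
    · rw [val_sl (hd _ h2)]
    · omega


/-! ### The action on cosets: counting vertices and lifting walks. -/

section Action

variable {G : Type*} [Group G] {π : SL →* G} {H : Subgroup G}

/-- Membership of `π y` in H places only `y` or `-y` in `binIco`, so invariance of the label under
-1 is required. -/
theorem orbitLabel_mul_of_map_mem (hπ : ∀ x, π x = 1 ↔ x = 1 ∨ x = -1)
    (hH : H = binIco.map π) {y : SL} (hy : π y ∈ H) (x : SL) :
    orbitLabel (x * y) = orbitLabel x := by
  rw [hH] at hy
  obtain ⟨z, hz, hzy⟩ := hy
  have h1 : π (z⁻¹ * y) = 1 := by rw [map_mul, map_inv, hzy, inv_mul_cancel]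
  have hy' : y = z * (z⁻¹ * y) := by rw [mul_inv_cancel_left]
  rcases (hπ _).1 h1 with h1 | h1
  · rw [hy', h1, mul_one, orbitLabel_mul_of_mem hz]
  · rw [hy', h1, mul_neg, mul_one, mul_neg, (orbitLabel_mul_generator _).2.2,
      orbitLabel_mul_of_mem hz]

/-- The image of the conjugate is killed by 60, the order of H, and by 61, hence is trivial. Then
`uni k` is ±1, and its upper right entry vanishes. -/
theorem eq_zero_of_conj_uni_mem (hπ : ∀ x, π x = 1 ↔ x = 1 ∨ x = -1)
    (hcard : Nat.card H = 60) {x : SL} {k : ZMod 61} (h : π (x⁻¹ * uni k * x) ∈ H) : k = 0 := by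
  have h60 : π (x⁻¹ * uni k * x) ^ 60 = 1 := by
    have := pow_card_eq_one' (x := (⟨_, h⟩ : H))
    rw [hcard] at this
    exact congrArg Subtype.val this
  have hpow (n : ℕ) : (x⁻¹ * uni k * x) ^ n = x⁻¹ * uni (n * k) * x := by
    have := conj_pow (i := n) (a := x⁻¹) (b := uni k)
    rw [inv_inv] at this
    rw [this, uni_pow]
  have h61 : π (x⁻¹ * uni k * x) ^ 61 = 1 := by
    rw [← map_pow, hpow, show ((61 : ℕ) : ZMod 61) = 0 from ZMod.natCast_self 61, zero_mul,
      uni_zero, mul_one, inv_mul_cancel, map_one]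
  rw [pow_succ, h60, one_mul] at h61
  have key : uni k = 1 ∨ uni k = -1 := by
    rcases (hπ _).1 h61 with h | h
    · left
      rw [mul_assoc, inv_mul_eq_one] at h
      exact mul_eq_right.1 h.symm
    · right
      rw [mul_assoc, inv_mul_eq_iff_eq_mul, mul_neg, mul_one] at h
      exact mul_right_cancel (b := x) (by rw [h, neg_one_mul])
  rcases key with h | h
  · have := congrArg (fun z : SL ↦ z.val 0 1) h
    simpa [val_uni, val_one] using this
  · have := congrArg (fun z : SL ↦ z.val 0 1) h
    simpa [val_uni, val_neg, val_one] using this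

theorem coset_eq_iff {x y : SL} :
    ((π x : G) : G ⧸ H) = (π y : G) ↔ π (x⁻¹ * y) ∈ H := by
  rw [QuotientGroup.eq, map_mul, map_inv]

/-- The label is thus well defined on `U`-orbits of vertices. -/
theorem orbitLabel_eq_of_coset_eq (hπ : ∀ x, π x = 1 ↔ x = 1 ∨ x = -1)
    (hH : H = binIco.map π) {x y : SL} {k l : ZMod 61}
    (h : ((π (uni k * x) : G) : G ⧸ H) = (π (uni l * y) : G)) :
    orbitLabel x = orbitLabel y := by
  have := orbitLabel_mul_of_map_mem hπ hH (coset_eq_iff.1 h) (uni k * x)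
  rw [mul_inv_cancel_left, orbitLabel_uni_mul, orbitLabel_uni_mul] at this
  exact this.symm

/-- This is the freeness of the action of `U` on the cosets. -/
theorem eq_of_uni_coset_eq (hπ : ∀ x, π x = 1 ↔ x = 1 ∨ x = -1)
    (hcard : Nat.card H = 60) {x : SL} {k l : ZMod 61}
    (h : ((π (uni k * x) : G) : G ⧸ H) = (π (uni l * x) : G)) : k = l := by
  have h' := coset_eq_iff.1 h
  have hk : (uni k)⁻¹ = uni (-k) := by
    rw [inv_eq_iff_mul_eq_one, ← uni_add, add_neg_cancel, uni_zero]
  rw [_root_.mul_inv_rev, hk, ← mul_assoc, mul_assoc x⁻¹, ← uni_add] at h'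
  have := eq_zero_of_conj_uni_mem hπ hcard h'
  linear_combination -this

theorem card_quotient (hs : Function.Surjective π) (hπ : ∀ x, π x = 1 ↔ x = 1 ∨ x = -1)
    (hH : H = binIco.map π) (hcard : Nat.card H = 60) : Nat.card (G ⧸ H) = 1891 := by
  let f : ZMod 61 × Fin 31 → G ⧸ H := fun p ↦ (π (uni p.1 * sl (repCode p.2)) : G)
  have hf : Function.Bijective f := by
    constructor
    · rintro ⟨k, i⟩ ⟨l, j⟩ h
      have hl := orbitLabel_eq_of_coset_eq hπ hH h
      rw [orbitLabel_repCode i.2, orbitLabel_repCode j.2] at hl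
      obtain rfl := Fin.ext hl
      exact Prod.ext (eq_of_uni_coset_eq hπ hcard h) rfl
    · intro q
      obtain ⟨g, rfl⟩ := QuotientGroup.mk_surjective q
      obtain ⟨x, rfl⟩ := hs g
      obtain ⟨j, hj, k, y, hy, h⟩ := exists_mul_eq_uni_mul x
      refine ⟨⟨k, ⟨j, hj⟩⟩, ?_⟩
      symm
      apply coset_eq_iff.2
      rw [← h, inv_mul_cancel_left, hH]
      exact Subgroup.mem_map_of_mem π hy
  rw [← Nat.card_congr (Equiv.ofBijective f hf), Nat.card_prod, Nat.card_zmod, Nat.card_fin]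

/-- An orbital graph contains all translates of the arcs from `H` to the cosets in some nontrivial
double coset. -/
theorem IsOrbitalGraph.exists_dcoset_adj (hs : Function.Surjective π) (hH : H = binIco.map π)
    (hdc : π (sl (dcosetCode 0)) = 1)
    {X : SimpleGraph (G ⧸ H)} (hX : IsOrbitalGraph G X) :
    ∃ i < 40, ∀ x : SL, ∀ y ∈ binIco,
      X.Adj ((π x : G) : G ⧸ H) (π (x * y * sl (dcosetCode (i + 1))) : G) := by
  obtain ⟨F, ⟨O, hO⟩, hF, hadj⟩ := hX
  obtain ⟨⟨p, q, hpq⟩, -⟩ := hF O hO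
  have hmem {y : SL} (hy : y ∈ binIco) : π y ∈ H := hH ▸ Subgroup.mem_map_of_mem π hy
  obtain ⟨a, rfl⟩ := QuotientGroup.mk_surjective p
  obtain ⟨b, rfl⟩ := QuotientGroup.mk_surjective q
  obtain ⟨a, rfl⟩ := hs a
  obtain ⟨b, rfl⟩ := hs b
  -- One orbital suffices: translating its arc from aH to bH by `c * a⁻¹` moves its tail to cH.
  have hall (c : SL) : X.Adj ((π c : G) : G ⧸ H) (π (c * (a⁻¹ * b)) : G) := by
    rw [hadj]
    refine ⟨O, hO, ?_⟩
    rw [hpq]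
    refine ⟨π (c * a⁻¹), ?_⟩
    change ((((π (c * a⁻¹)) * π a : G) : G ⧸ H), (((π (c * a⁻¹)) * π b : G) : G ⧸ H)) = _
    rw [← map_mul, ← map_mul, inv_mul_cancel_right, mul_assoc]
  obtain ⟨i, hi, y, hy, z, hz, h⟩ := exists_dcoset (a⁻¹ * b)
  have hall' (x w : SL) (hw : w ∈ binIco) :
      X.Adj ((π x : G) : G ⧸ H) (π (x * w * sl (dcosetCode i)) : G) := by
    -- The tail is still xH, as `w * z⁻¹` is icosahedral. Since `a⁻¹ * b` equals `z * d * y⁻¹` with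
    -- `d` the representative, the head is the coset of `x * w * d`.
    have h1 := hall (x * w * z⁻¹)
    rwa [(coset_eq_iff (x := x * w * z⁻¹) (y := x)).2 (by
        rw [← H.inv_mem_iff, ← map_inv]
        simp only [_root_.mul_inv_rev, inv_inv]
        rw [mul_assoc, inv_mul_cancel_left]
        exact hmem (mul_mem hw (inv_mem hz))),
      (coset_eq_iff (x := x * w * z⁻¹ * (a⁻¹ * b)) (y := x * w * sl (dcosetCode i))).2 (by
        rw [← inv_mul_eq_iff_eq_mul.2 h]
        convert hmem hy using 2
        group)] at h1
  -- The representative with index 0 maps to the identity and would give a loop.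
  obtain _ | i := i
  · refine absurd (hall' 1 1 (one_mem _)) ?_
    rw [mul_one, one_mul, hdc, map_one]
    exact X.irrefl
  · exact ⟨i, by omega, fun x y hy ↦ hall' x y hy⟩

theorem exists_isHamiltonianCycle [DecidableEq (G ⧸ H)] (hs : Function.Surjective π)
    (hπ : ∀ x, π x = 1 ↔ x = 1 ∨ x = -1)
    (hH : H = binIco.map π) (hcard : Nat.card H = 60)
    {X : SimpleGraph (G ⧸ H)} (hX : IsOrbitalGraph G X) :
    ∃ (v : G ⧸ H) (p : X.Walk v v), p.IsHamiltonianCycle := by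
  have hdc : π (sl (dcosetCode 0)) = 1 := by
    rw [hπ]
    left
    apply Subtype.ext
    rw [val_sl (detOne_dcosetCode (by omega)), val_one]
    decide +kernel
  obtain ⟨i, hi, hadj⟩ := IsOrbitalGraph.exists_dcoset_adj hs hH hdc hX
  obtain ⟨g, k, hk, hg, hinj, hstep⟩ := exists_walk hi
  refine X.exists_isHamiltonianCycle_of_periodic 1891 (by norm_num)
    (card_quotient hs hπ hH hcard)
    -- The lifted path is repeated, translated once more by `uni k` after every 31 steps.
    (fun n ↦ ((π (uni ((n / 31 : ℕ) * k) * g (n % 31)) : G) : G ⧸ H)) ?_ ?_ ?_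
  · intro n _
    obtain ⟨y, hy, h⟩ := hstep (n % 31) (Nat.mod_lt _ (by norm_num))
    have := hadj (uni ((n / 31 : ℕ) * k) * g (n % 31)) y hy
    rw [mul_assoc (uni _), mul_assoc (uni _), h] at this
    rcases Nat.lt_or_ge (n % 31 + 1) 31 with hn | hn
    · rw [show (n + 1) / 31 = n / 31 by omega, show (n + 1) % 31 = n % 31 + 1 by omega]
      exact this
    · rw [show n % 31 + 1 = 31 by omega, hg, ← mul_assoc, ← uni_add] at this
      rw [show (n + 1) / 31 = n / 31 + 1 by omega, show (n + 1) % 31 = 0 by omega]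
      push_cast
      rwa [add_one_mul]
  -- After 1891 = 31 · 61 steps the accumulated translation is 61k = 0.
  · norm_num
    rw [show (61 : ZMod 61) = 0 from by decide, zero_mul]
  · intro m hm n hn h
    simp only [Set.mem_Iio] at hm hn
    have h1 := hinj (Nat.mod_lt m (by norm_num) : m % 31 < 31)
      (Nat.mod_lt n (by norm_num) : n % 31 < 31) (orbitLabel_eq_of_coset_eq hπ hH h)
    simp only [h1] at h
    -- Equal labels give equal positions in the path, and freeness of `U` with `k ≠ 0` gives equal
    -- quotients modulo 61; these quotients are below 61.
    have h2 := mul_right_cancel₀ hk (eq_of_uni_coset_eq hπ hcard h)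
    rw [ZMod.natCast_eq_natCast_iff', Nat.mod_eq_of_lt (by omega), Nat.mod_eq_of_lt (by omega)] at h2
    omega

end Action


/-! ### Conjugacy of icosahedral generating pairs. -/

/-- Conjugation by an invertible matrix, as an endomorphism of the special linear group. -/
noncomputable def conj (P : Matrix (Fin 2) (Fin 2) (ZMod 61)) (hP : IsUnit P.det) : SL →* SL where
  toFun x := ⟨P * x.val * P⁻¹, by
    rw [Matrix.det_mul, Matrix.det_mul, x.2, mul_one, ← Matrix.det_mul,
      Matrix.mul_nonsing_inv _ hP, Matrix.det_one]⟩
  map_one' := by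
    apply Subtype.ext
    change P * (1 : SL).val * P⁻¹ = 1
    rw [val_one, mul_one, Matrix.mul_nonsing_inv _ hP]
  map_mul' x y := by
    apply Subtype.ext
    change P * (x * y).val * P⁻¹ = (P * x.val * P⁻¹) * (P * y.val * P⁻¹)
    rw [val_mul]
    simp only [mul_assoc]
    rw [← mul_assoc P⁻¹ P, Matrix.nonsing_inv_mul _ hP, one_mul]

theorem val_conj {P : Matrix (Fin 2) (Fin 2) (ZMod 61)} (hP : IsUnit P.det) (x : SL) :
    (conj P hP x).val = P * x.val * P⁻¹ := rfl

/-- Clearing the inverse leaves a matrix identity that can be decided for concrete matrices. -/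
theorem conj_eq_iff {P : Matrix (Fin 2) (Fin 2) (ZMod 61)} (hP : IsUnit P.det) {x y : SL} :
    conj P hP x = y ↔ P * x.val = y.val * P := by
  constructor
  · intro h
    rw [← h, val_conj, Matrix.nonsing_inv_mul_cancel_right _ _ hP]
  · intro h
    apply Subtype.ext
    rw [val_conj, h, Matrix.mul_nonsing_inv_cancel_right _ _ hP]

theorem conj_surjective {P : Matrix (Fin 2) (Fin 2) (ZMod 61)} (hP : IsUnit P.det) :
    Function.Surjective (conj P hP) := by
  intro y
  refine ⟨conj P⁻¹ (Matrix.isUnit_nonsing_inv_det P hP) y, ?_⟩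
  rw [conj_eq_iff, val_conj, Matrix.nonsing_inv_nonsing_inv _ hP, mul_assoc,
    Matrix.mul_nonsing_inv_cancel_left _ _ hP]

theorem conj_injective {P : Matrix (Fin 2) (Fin 2) (ZMod 61)} (hP : IsUnit P.det) :
    Function.Injective (conj P hP) := by
  intro x y h
  rw [conj_eq_iff, val_conj, Matrix.nonsing_inv_mul_cancel_right _ _ hP] at h
  apply Subtype.ext
  rw [← Matrix.nonsing_inv_mul_cancel_left P x.val hP, h,
    Matrix.nonsing_inv_mul_cancel_left P _ hP]

/-- The other standard generator of order four, for the Galois conjugate value of the trace. -/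
def altA : SL := ⟨!![11, 29; 0, 50], by rw [Matrix.det_fin_two_of]; decide⟩

theorem isUnit_det_of_ne_zero {P : Matrix (Fin 2) (Fin 2) (ZMod 61)} (h : P.det ≠ 0) :
    IsUnit P.det := isUnit_iff_ne_zero.2 h

/-- One binary icosahedral group contains generating pairs for both roots t. The word `y` below is
such that `altA` and `y` form a pair for t = 44, conjugate to `stdA`, `stdB`, and a word in the
opposite direction recovers `stdB`. -/
theorem exists_conj_eq_altA : ∃ (Q : Matrix (Fin 2) (Fin 2) (ZMod 61)) (hQ : IsUnit Q.det),
    Subgroup.closure {altA, stdB} = binIco.map (conj Q hQ) := by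
  have hQ : IsUnit (!![1, 34; 0, 35] : Matrix (Fin 2) (Fin 2) (ZMod 61)).det :=
    isUnit_det_of_ne_zero (by rw [Matrix.det_fin_two_of]; decide)
  refine ⟨!![1, 34; 0, 35], hQ, ?_⟩
  set y := altA * stdB * altA * stdB * stdB * altA * stdB with hy
  have hA : conj _ hQ stdA = altA := by
    rw [conj_eq_iff]
    decide
  have hB : conj _ hQ stdB = y := by
    rw [conj_eq_iff]
    decide
  have hyB : stdB = y * altA * y * y * altA * y * altA := by decide
  have ha : altA ∈ Subgroup.closure {altA, stdB} := Subgroup.subset_closure (by simp)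
  have hb : stdB ∈ Subgroup.closure {altA, stdB} := Subgroup.subset_closure (by simp)
  have ha' : altA ∈ Subgroup.closure {altA, y} := Subgroup.subset_closure (by simp)
  have hy' : y ∈ Subgroup.closure {altA, y} := Subgroup.subset_closure (by simp)
  rw [binIco, MonoidHom.map_closure, Set.image_pair, hA, hB]
  apply le_antisymm
  · rw [Subgroup.closure_le]
    rintro _ (rfl | rfl)
    · exact ha'
    · rw [hyB]
      exact mul_mem (mul_mem (mul_mem (mul_mem (mul_mem (mul_mem hy' ha') hy') hy') ha') hy') ha'
  · rw [Subgroup.closure_le]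
    rintro _ (rfl | rfl)
    · exact ha
    · exact mul_mem (mul_mem (mul_mem (mul_mem (mul_mem (mul_mem ha hb) ha) hb) hb) ha) hb

theorem fin_two_congr {R : Type*} {a b c d a' b' c' d' : R} (h1 : a = a') (h2 : b = b')
    (h3 : c = c') (h4 : d = d') : !![a, b; c, d] = !![a', b'; c', d'] := by
  rw [h1, h2, h3, h4]

/-- Matrices with the traces of icosahedral generators are simultaneously conjugate to a normal
form. -/
theorem exists_conj_normal_form (x y : SL) (hx : x.val.trace = 0) (hy : y.val.trace = 1)
    (ht : (x * y).val.trace ^ 2 - (x * y).val.trace - 1 = 0) :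
    ∃ (P : Matrix (Fin 2) (Fin 2) (ZMod 61)), IsUnit P.det ∧
      x.val * P = P * !![11, (x * y).val.trace + 11; 0, 50] ∧ y.val * P = P * !![0, 60; 1, 1] := by
  have hdx := x.2
  have hdy := y.2
  rw [Matrix.det_fin_two] at hdx hdy
  rw [Matrix.trace_fin_two] at hx hy
  have c50 : (50 : ZMod 61) = -11 := by decide
  have c60 : (60 : ZMod 61) = -1 := by decide
  have c122 : (122 : ZMod 61) = 0 := by decide
  -- Here 11² = -1, so 11 is a root of the characteristic polynomial X² + 1 of `x`, and v is an
  -- eigenvector.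
  obtain ⟨v, hv0, hv⟩ : ∃ v ≠ 0, (x.val - !![11, 0; 0, 11]).mulVec v = 0 := by
    rw [Matrix.exists_mulVec_eq_zero_iff, Matrix.det_fin_two]
    simp only [Matrix.sub_apply, Matrix.of_apply, Matrix.cons_val', Matrix.cons_val_zero,
      Matrix.cons_val_one, Matrix.cons_val_fin_one]
    linear_combination hdx - 11 * hx + c122
  have e0 := congrFun hv 0
  have e1 := congrFun hv 1
  simp [Matrix.mulVec, dotProduct, Fin.sum_univ_two] at e0 e1
  have htt : (x * y).val.trace =
      x.val 0 0 * y.val 0 0 + x.val 0 1 * y.val 1 0 + (x.val 1 0 * y.val 0 1 + x.val 1 1 * y.val 1 1) := by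
    rw [Matrix.trace_fin_two, val_mul, Matrix.mul_apply, Matrix.mul_apply, Fin.sum_univ_two,
      Fin.sum_univ_two]
  generalize (x * y).val.trace = t at *
  have hxe := Matrix.eta_fin_two x.val
  have hye := Matrix.eta_fin_two y.val
  generalize x.val 0 0 = a, x.val 0 1 = b, x.val 1 0 = c, x.val 1 1 = d at *
  generalize y.val 0 0 = e, y.val 0 1 = f, y.val 1 0 = g, y.val 1 1 = h at *
  obtain rfl : d = -a := by linear_combination hx
  obtain rfl : h = 1 - e := by linear_combination hy
  -- `key0` and `key1` are the coordinates of xyv = (t + 11)v - 11yv, which follows from xy + (xy)⁻¹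
  -- = t with x⁻¹ = -x and y⁻¹ = 1 - y.
  have key0 : a * (e * v 0 + f * v 1) + b * (g * v 0 + (1 - e) * v 1) =
      (t + 11) * v 0 - 11 * (e * v 0 + f * v 1) := by
    linear_combination (1 - e) * e0 - f * e1 - v 0 * htt
  have key1 : c * (e * v 0 + f * v 1) + -a * (g * v 0 + (1 - e) * v 1) =
      (t + 11) * v 1 - 11 * (g * v 0 + (1 - e) * v 1) := by
    linear_combination e1 - g * e0 - (1 - e) * e1 - v 1 * htt
  -- The new basis is v, yv.
  refine ⟨!![v 0, e * v 0 + f * v 1; v 1, g * v 0 + (1 - e) * v 1], ?_, ?_, ?_⟩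
  · apply isUnit_det_of_ne_zero
    rw [Matrix.det_fin_two_of]
    intro hdet
    -- If v and yv were dependent, v would be a common eigenvector, with yv = βv. Then β² - β + 1 =
    -- 0 and t + 11 = 22β, which no β modulo 61 reconciles with t² - t - 1 = 0.
    obtain ⟨β, h0, h1⟩ : ∃ β, e * v 0 + f * v 1 = β * v 0 ∧ g * v 0 + (1 - e) * v 1 = β * v 1 := by
      by_cases hz : v 0 = 0
      · have hz1 : v 1 ≠ 0 := fun hz1 ↦ hv0 (by ext i; fin_cases i <;> assumption)
        refine ⟨(g * v 0 + (1 - e) * v 1) / v 1, ?_, ?_⟩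
        · field_simp
          linear_combination -hdet
        · field_simp
      · refine ⟨(e * v 0 + f * v 1) / v 0, ?_, ?_⟩
        · field_simp
        · field_simp
          linear_combination hdet
    have hβ (i : Fin 2) : (β ^ 2 - β + 1) * v i = 0 ∧ (t + 11 - 22 * β) * v i = 0 := by
      rw [h0, h1] at key0 key1
      fin_cases i
      · constructor
        · change _ * v 0 = 0
          linear_combination -(β - 1 + e) * h0 - f * h1 - v 0 * hdy
        · change _ * v 0 = 0
          linear_combination β * e0 - key0
      · constructor
        · change _ * v 1 = 0
          linear_combination -g * h0 - (β - e) * h1 - v 1 * hdy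
        · change _ * v 1 = 0
          linear_combination β * e1 - key1
    obtain ⟨i, hi⟩ := Function.ne_iff.1 hv0
    have hb1 := (mul_eq_zero.1 (hβ i).1).resolve_right hi
    have hb2 := (mul_eq_zero.1 (hβ i).2).resolve_right hi
    obtain rfl : t = 22 * β - 11 := by linear_combination hb2
    revert hb1 ht
    clear * -
    revert β
    decide
  · rw [hxe, Matrix.mul_fin_two, Matrix.mul_fin_two, c50]
    apply fin_two_congr
    · linear_combination e0
    · linear_combination key0
    · linear_combination e1
    · linear_combination key1
  · rw [hye, Matrix.mul_fin_two, Matrix.mul_fin_two, c60]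
    apply fin_two_congr
    · ring
    · linear_combination -v 0 * hdy
    · ring
    · linear_combination -v 1 * hdy

theorem exists_conj_closure_eq (x y : SL) (hx : x.val.trace = 0) (hy : y.val.trace = 1)
    (ht : (x * y).val.trace ^ 2 - (x * y).val.trace - 1 = 0) :
    ∃ (P : Matrix (Fin 2) (Fin 2) (ZMod 61)) (hP : IsUnit P.det),
      Subgroup.closure {x, y} = binIco.map (conj P hP) := by
  obtain ⟨P, hP, hPx, hPy⟩ := exists_conj_normal_form x y hx hy ht
  have hy' : conj P hP stdB = y := (conj_eq_iff hP).2 hPy.symm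
  have ht' : ∀ t : ZMod 61, t ^ 2 - t - 1 = 0 → t = 44 ∨ t = 18 := by decide
  rcases ht' _ ht with h | h
  · have hx' : conj P hP stdA = x := by
      rw [conj_eq_iff, hPx, h]
      congr 1
    exact ⟨P, hP, by rw [binIco, MonoidHom.map_closure, Set.image_pair, hx', hy']⟩
  · have hx' : conj P hP altA = x := by
      rw [conj_eq_iff, hPx, h]
      congr 1
    obtain ⟨Q, hQ, h⟩ := exists_conj_eq_altA
    refine ⟨P * Q, by rw [Matrix.det_mul]; exact hP.mul hQ, ?_⟩
    have hc : conj (P * Q) (by rw [Matrix.det_mul]; exact hP.mul hQ) =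
        (conj P hP).comp (conj Q hQ) := by
      ext1 z
      apply Subtype.ext
      rw [MonoidHom.comp_apply, val_conj, val_conj, val_conj, Matrix.mul_inv_rev]
      simp only [mul_assoc]
    rw [hc, ← Subgroup.map_map, ← h, MonoidHom.map_closure, Set.image_pair, hx', hy']

/-! ### Orders in the projective group and traces of lifts. -/

/-- By Cayley–Hamilton z² = tz - 1 with t the trace, so all powers of z obey a linear recursion. -/
theorem trace_pow_coeff (z : SL) (i j : Fin 2) :
    (z ^ 2).val i j = z.val.trace * z.val i j - (1 : Matrix (Fin 2) (Fin 2) (ZMod 61)) i j ∧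
    (z ^ 3).val i j = (z.val.trace ^ 2 - 1) * z.val i j -
      z.val.trace * (1 : Matrix (Fin 2) (Fin 2) (ZMod 61)) i j ∧
    (z ^ 5).val i j = (z.val.trace ^ 4 - 3 * z.val.trace ^ 2 + 1) * z.val i j -
      (z.val.trace ^ 3 - 2 * z.val.trace) * (1 : Matrix (Fin 2) (Fin 2) (ZMod 61)) i j := by
  have h2 : z.val * z.val = z.val.trace • z.val - 1 := by
    have := z.2
    rw [Matrix.det_fin_two] at this
    rw [Matrix.trace_fin_two]
    ext i j
    fin_cases i <;> fin_cases j <;>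
      simp [Matrix.mul_apply, Fin.sum_univ_two]
    · linear_combination -this
    · ring
    · ring
    · linear_combination -this
  have step (n : ℕ) : (z ^ (n + 2)).val i j =
      z.val.trace * (z ^ (n + 1)).val i j - (z ^ n).val i j := by
    rw [pow_succ, pow_succ, mul_assoc, val_mul, val_mul, val_mul, h2, mul_sub, mul_one,
      Matrix.mul_smul, Matrix.sub_apply, Matrix.smul_apply, smul_eq_mul]
  have s0 := step 0
  have s1 := step 1
  have s2 := step 2
  have s3 := step 3
  simp only [zero_add, pow_zero, pow_one, val_one, Nat.reduceAdd] at s0 s1 s2 s3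
  refine ⟨s0, ?_, ?_⟩
  · rw [s1, s0]; ring
  · rw [s3, s2, s1, s0]; ring

theorem eq_one_or_neg_one {z : SL} (h01 : z.val 0 1 = 0) (h10 : z.val 1 0 = 0)
    (h : z.val 0 0 = z.val 1 1) : z = 1 ∨ z = -1 := by
  have hd := z.2
  rw [Matrix.det_fin_two, h01, h10, ← h] at hd
  have h1 : (z.val 0 0 - 1) * (z.val 0 0 + 1) = 0 := by linear_combination hd
  have hz := Matrix.eta_fin_two z.val
  rcases mul_eq_zero.1 h1 with h1 | h1
  · left
    apply Subtype.ext
    rw [hz, h01, h10, ← h, sub_eq_zero.1 h1, val_one, Matrix.one_fin_two]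
  · right
    apply Subtype.ext
    rw [hz, h01, h10, ← h, eq_neg_of_add_eq_zero_left h1, val_neg, val_one, Matrix.one_fin_two]
    simp

theorem mk_eq_one_iff (z : SL) : QuotientGroup.mk' (Subgroup.center SL) z = 1 ↔ z = 1 ∨ z = -1 := by
  rw [QuotientGroup.mk'_apply, QuotientGroup.eq_one_iff]
  constructor
  · intro h
    obtain ⟨r, -, hr⟩ := Matrix.SpecialLinearGroup.mem_center_iff.1 h
    apply eq_one_or_neg_one
    · rw [← hr]; simp
    · rw [← hr]; simp
    · rw [← hr]; simp
  · rintro (rfl | rfl)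
    · exact one_mem _
    · rw [Subgroup.mem_center_iff]
      intro g
      rw [mul_neg, neg_mul, mul_one, one_mul]

/-- If a power of a noncentral `z` that is the linear combination `c z + d` is central, then
`c = 0`. -/
theorem coeff_eq_zero {z w : SL} (hz : ¬ (z = 1 ∨ z = -1)) (hw : w = 1 ∨ w = -1) {c d : ZMod 61}
    (h : ∀ i j, w.val i j = c * z.val i j - d * (1 : Matrix (Fin 2) (Fin 2) (ZMod 61)) i j) :
    c = 0 := by
  by_contra hc
  have hw' : w.val 0 1 = 0 ∧ w.val 1 0 = 0 ∧ w.val 0 0 = w.val 1 1 := by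
    rcases hw with rfl | rfl
    · simp
    · simp
  obtain ⟨h1, h2, h3⟩ := hw'
  rw [h 0 1, Matrix.one_apply_ne (by decide), mul_zero, sub_zero] at h1
  rw [h 1 0, Matrix.one_apply_ne (by decide), mul_zero, sub_zero] at h2
  rw [h 0 0, h 1 1, Matrix.one_apply_eq, Matrix.one_apply_eq, sub_left_inj] at h3
  exact hz (eq_one_or_neg_one ((mul_eq_zero.1 h1).resolve_left hc)
    ((mul_eq_zero.1 h2).resolve_left hc) (mul_left_cancel₀ hc h3))

theorem trace_neg_val (z : SL) : (-z).val.trace = -z.val.trace := by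
  rw [val_neg, Matrix.trace_neg]

/-- Generators of order two and three with a product of order five lift to matrices with the traces
of icosahedral generators. -/
theorem exists_lifts (a b : SL ⧸ Subgroup.center SL) (ha : a ^ 2 = 1) (hb : b ^ 3 = 1)
    (hab : (a * b) ^ 5 = 1) (ha1 : a ≠ 1) (hb1 : b ≠ 1) (hab1 : a * b ≠ 1) :
    ∃ x y : SL, QuotientGroup.mk' (Subgroup.center SL) x = a ∧
      QuotientGroup.mk' (Subgroup.center SL) y = b ∧ x.val.trace = 0 ∧ y.val.trace = 1 ∧
      (x * y).val.trace ^ 2 - (x * y).val.trace - 1 = 0 := by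
  obtain ⟨x, rfl⟩ := QuotientGroup.mk'_surjective _ a
  obtain ⟨y, rfl⟩ := QuotientGroup.mk'_surjective _ b
  have hneg (z : SL) : QuotientGroup.mk' (Subgroup.center SL) (-z) =
      QuotientGroup.mk' (Subgroup.center SL) z := by
    rw [← neg_one_mul, map_mul, (mk_eq_one_iff (-1)).2 (Or.inr rfl), one_mul]
  rw [← map_pow, mk_eq_one_iff] at ha hb
  rw [← map_mul, ← map_pow, mk_eq_one_iff] at hab
  rw [Ne, mk_eq_one_iff] at ha1 hb1
  rw [← map_mul, Ne, mk_eq_one_iff] at hab1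
  have tx : x.val.trace = 0 := coeff_eq_zero (d := 1) ha1 ha fun i j ↦ by
    rw [(trace_pow_coeff x i j).1, one_mul]
  have ty := coeff_eq_zero hb1 hb fun i j ↦ (trace_pow_coeff y i j).2.1
  have txy := coeff_eq_zero hab1 hab fun i j ↦ (trace_pow_coeff (x * y) i j).2.2
  -- The trace of `y` is ±1, and the sign of the lift is free; the quartic in the trace of the
  -- product is even, so it survives.
  obtain ⟨y', hy', hty, hxy⟩ : ∃ y', (y' = y ∨ y' = -y) ∧ y'.val.trace = 1 ∧
      (x * y').val.trace ^ 4 - 3 * (x * y').val.trace ^ 2 + 1 = 0 := by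
    have h : (y.val.trace - 1) * (y.val.trace + 1) = 0 := by linear_combination ty
    rcases mul_eq_zero.1 h with h | h
    · exact ⟨y, Or.inl rfl, by linear_combination h, txy⟩
    · refine ⟨-y, Or.inr rfl, ?_, ?_⟩
      · rw [trace_neg_val]; linear_combination -h
      · rw [mul_neg, trace_neg_val]; linear_combination txy
  have hy : QuotientGroup.mk' (Subgroup.center SL) y' = QuotientGroup.mk' (Subgroup.center SL) y := by
    rcases hy' with rfl | rfl
    · rfl
    · exact hneg y
  -- The quartic splits into two quadratics exchanged by t ↦ -t; the sign of `x` selects the right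
  -- one and keeps its trace 0.
  have h : ((x * y').val.trace ^ 2 - (x * y').val.trace - 1) *
      ((x * y').val.trace ^ 2 + (x * y').val.trace - 1) = 0 := by linear_combination hxy
  rcases mul_eq_zero.1 h with h | h
  · exact ⟨x, y', rfl, hy, tx, hty, h⟩
  · refine ⟨-x, y', hneg x, hy, by rw [trace_neg_val, neg_eq_zero]; exact tx, hty, ?_⟩
    rw [neg_mul, trace_neg_val]
    linear_combination h


/-! ### Generators of A₅ and the reduction of an arbitrary H to the standard group. -/

theorem nat_card_alternatingGroup_five : Nat.card (alternatingGroup (Fin 5)) = 60 := by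
  rw [nat_card_alternatingGroup, Nat.card_fin]
  decide

theorem exists_alternatingGroup_five_generators : ∃ a b : alternatingGroup (Fin 5),
    a ^ 2 = 1 ∧ b ^ 3 = 1 ∧ (a * b) ^ 5 = 1 ∧ a ≠ 1 ∧ b ≠ 1 ∧ a * b ≠ 1 ∧
      Subgroup.closure {a, b} = ⊤ := by
  let a : alternatingGroup (Fin 5) :=
    ⟨Equiv.swap 0 1 * Equiv.swap 2 3, Equiv.Perm.mem_alternatingGroup.2 (by decide)⟩
  let b : alternatingGroup (Fin 5) :=
    ⟨Equiv.swap 0 2 * Equiv.swap 2 4, Equiv.Perm.mem_alternatingGroup.2 (by decide)⟩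
  have h2 : a ^ 2 = 1 := by decide
  have h3 : b ^ 3 = 1 := by decide
  have h5 : (a * b) ^ 5 = 1 := by decide
  have n2 : a ≠ 1 := by decide
  have n3 : b ≠ 1 := by decide
  have n5 : a * b ≠ 1 := by decide
  refine ⟨a, b, h2, h3, h5, n2, n3, n5, ?_⟩
  set N := Subgroup.closure {a, b} with hN
  have ha : a ∈ N := Subgroup.subset_closure (by simp)
  have hb : b ∈ N := Subgroup.subset_closure (by simp)
  have hdvd {p : ℕ} (hp : p.Prime) {c : alternatingGroup (Fin 5)} (hc : c ∈ N) (hcp : c ^ p = 1)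
      (hc1 : c ≠ 1) : p ∣ Nat.card N := by
    have := Fact.mk hp
    rw [← orderOf_eq_prime hcp hc1]
    exact Subgroup.orderOf_dvd_natCard N hc
  have d2 := hdvd Nat.prime_two ha h2 n2
  have d3 := hdvd Nat.prime_three hb h3 n3
  have d5 := hdvd Nat.prime_five (mul_mem ha hb) h5 n5
  have hmul := N.card_mul_index
  rw [nat_card_alternatingGroup_five] at hmul
  -- Elements of orders 2, 3 and 5 leave index 1 or 2; index 2 would give a proper nontrivial normal
  -- subgroup of the simple group A₅.
  obtain ⟨m, hm⟩ : 30 ∣ Nat.card N := by omega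
  have hm2 : m * N.index = 2 := by rw [hm, mul_assoc] at hmul; omega
  rcases (Nat.dvd_prime Nat.prime_two).1 (Dvd.intro_left _ hm2) with h | h
  · exact Subgroup.index_eq_one.1 h
  · have := Subgroup.normal_of_index_eq_two h
    refine (Subgroup.Normal.eq_bot_or_eq_top this).resolve_left fun hbot ↦ n2 ?_
    rwa [hbot, Subgroup.mem_bot] at ha

/-- Every subgroup of `PSL(2, 61)` isomorphic to `A₅` is the image of the standard binary icosahedral
group under some projection of `SL(2, 61)` onto `PSL(2, 61)`. -/
theorem exists_projection (H : Subgroup (SL ⧸ Subgroup.center SL))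
    (e : H ≃* alternatingGroup (Fin 5)) :
    ∃ π : SL →* SL ⧸ Subgroup.center SL, Function.Surjective π ∧
      (∀ x, π x = 1 ↔ x = 1 ∨ x = -1) ∧ H = binIco.map π := by
  obtain ⟨a, b, h2, h3, h5, n2, n3, n5, hab⟩ := exists_alternatingGroup_five_generators
  let f : alternatingGroup (Fin 5) →* SL ⧸ Subgroup.center SL := H.subtype.comp e.symm.toMonoidHom
  have hf : Function.Injective f := H.subtype_injective.comp e.symm.injective
  have hH : H = Subgroup.closure {f a, f b} := by
    rw [← Set.image_pair, ← MonoidHom.map_closure, hab, ← MonoidHom.range_eq_map,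
      MonoidHom.range_comp, MonoidHom.range_eq_top.2 e.symm.surjective, ← MonoidHom.range_eq_map,
      Subgroup.range_subtype]
  obtain ⟨x, y, hx, hy, tx, ty, txy⟩ := exists_lifts (f a) (f b)
    (by rw [← map_pow, h2, map_one]) (by rw [← map_pow, h3, map_one])
    (by rw [← map_mul, ← map_pow, h5, map_one]) ((map_ne_one_iff f hf).2 n2)
    ((map_ne_one_iff f hf).2 n3) (by rw [← map_mul]; exact (map_ne_one_iff f hf).2 n5)
  obtain ⟨P, hP, hcl⟩ := exists_conj_closure_eq x y tx ty txy
  have hneg : conj P hP (-1) = -1 := by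
    rw [conj_eq_iff, val_neg, val_one, mul_neg, mul_one, neg_mul, one_mul]
  -- The conjugating matrix need not have determinant one, so it is absorbed into the projection
  -- rather than used to move H inside G.
  refine ⟨(QuotientGroup.mk' _).comp (conj P hP),
    (QuotientGroup.mk'_surjective _).comp (conj_surjective hP), fun z ↦ ?_, ?_⟩
  · rw [MonoidHom.comp_apply, mk_eq_one_iff, map_eq_one_iff _ (conj_injective hP)]
    refine or_congr_right ⟨fun h ↦ conj_injective hP (h.trans hneg.symm), fun h ↦ h ▸ hneg⟩
  · rw [← Subgroup.map_map, ← hcl, MonoidHom.map_closure, Set.image_pair, hx, hy, hH]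

end PSL61

theorem proposition5p2
    (H : Subgroup (Matrix.ProjectiveSpecialLinearGroup (Fin 2) (ZMod 61)))
    (hH : Nonempty (H ≃* alternatingGroup (Fin 5)))
    [DecidableEq (Matrix.ProjectiveSpecialLinearGroup (Fin 2) (ZMod 61) ⧸ H)] :
    Nat.card (Matrix.ProjectiveSpecialLinearGroup (Fin 2) (ZMod 61) ⧸ H) = 1891 ∧
    ∀ X : SimpleGraph (Matrix.ProjectiveSpecialLinearGroup (Fin 2) (ZMod 61) ⧸ H),
      IsOrbitalGraph (Matrix.ProjectiveSpecialLinearGroup (Fin 2) (ZMod 61)) X →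
      ∃ (v : Matrix.ProjectiveSpecialLinearGroup (Fin 2) (ZMod 61) ⧸ H) (p : X.Walk v v),
        p.IsHamiltonianCycle := by
  obtain ⟨e⟩ := hH
  have hcard : Nat.card H = 60 :=
    (Nat.card_congr e.toEquiv).trans PSL61.nat_card_alternatingGroup_five
  obtain ⟨π, hs, hπ, hHπ⟩ := PSL61.exists_projection H e
  exact ⟨PSL61.card_quotient hs hπ hHπ hcard,
    fun X hX ↦ PSL61.exists_isHamiltonianCycle hs hπ hHπ hcard hX⟩
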